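/- Let $V$ be a real topological vector space (for instance a finite-dimensional real vector space) with dual $V^\vee$, and let $W$ be a finite group of continuous linear automorphisms of $V$ such that $(W,S)$ is a Coxeter system whose finite set $S$ of generators consists of reflections. For $s\in S$ let $\alpha_s\in V$ and $\alpha_s^\vee\in V^\vee$ be the simple roots and coroots: $\alpha_s^\vee(\alpha_s)=2$, $s(v)=v-\alpha_s^\vee(v)\alpha_s$ for $v\in V$, and, for $s\neq t$ in $S$ with $m(s,t)$ the order of $st$, $$\alpha_s^\vee(\alpha_t)\le 0,\qquad \alpha_s^\vee(\alpha_t)\,\alpha_t^\vee(\alpha_s)=4\cos^2\frac{\pi}{m(s,t)} .$$ Let $w_0$ be the longest element of $W$. Fix $T>0$ and consider the continuous paths $\pi:[0,T]\to V$ with $\pi(0)=0$. For such paths put $$\mathcal P_s\pi(t)=\pi(t)-\inf_{0\le r\le t}\alpha_s^\vee(\pi(r))\,\alpha_s,\qquad \kappa\pi(t)=\pi(T-t)-\pi(T),\qquad ((-w_0)\pi)(t)=-w_0(\pi(t)),$$ let $\mathcal P_{w_0}=\mathcal P_{s_1}\cdots\mathcal P_{s_q}$, where $w_0=s_1\cdots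 s_q$ is a reduced decomposition, and let $I=\mathcal P_{w_0}(-w_0)\kappa$. Call $\pi$ dominant if $\alpha_s^\vee(\pi(t))\ge 0$ for all $s\in S$ and $t\in[0,T]$. Then $\mathcal P_{w_0}$ does not depend on the chosen reduced decomposition of $w_0$, and: (i) $I^2=\mathcal P_{w_0}$; (ii) $I$ maps dominant paths to dominant paths, and its restriction to dominant paths is an involution; (iii) $I\mathcal P_{w_0}=I$; (iv) for every path $\pi$, $I\pi(T)=\mathcal P_{w_0}\pi(T)$; in particular $I\pi(T)=\pi(T)$ when $\pi$ is dominant. -/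

import Mathlib

/-- Continuous paths `π : [0, T] → V` with `π(0) = 0`. -/
@[ext]
structure PitmanPath (T : ℝ) (V : Type*) [AddCommGroup V] [TopologicalSpace V] where
  toFun : Set.Icc (0 : ℝ) T → V
  continuous_toFun : Continuous toFun
  map_zero : ∀ t : Set.Icc (0 : ℝ) T, (t : ℝ) = 0 → toFun t = 0

namespace PitmanPath

section Operators

variable {T : ℝ} {V : Type*} [AddCommGroup V] [Module ℝ V] [TopologicalSpace V]
  [IsTopologicalAddGroup V] [ContinuousSMul ℝ V]

instance : CoeFun (PitmanPath T V) (fun _ => Set.Icc (0 : ℝ) T → V) := ⟨toFun⟩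

/-- The running infimum `inf_{0 ≤ s ≤ t} β(π(s))`. -/
noncomputable def runningInf (β : V →L[ℝ] ℝ) (π : PitmanPath T V) (t : Set.Icc (0 : ℝ) T) : ℝ :=
  sInf ((fun s => β (π s)) '' Set.Iic t)

theorem continuous_runningInf (β : V →L[ℝ] ℝ) (π : PitmanPath T V) :
    Continuous (runningInf β π) := by
  have h : runningInf β π = fun t => sInf ((fun s => β (π (min s t))) '' Set.univ) := by
    funext t
    unfold runningInf
    congr 1
    ext x
    constructor
    · rintro ⟨s, hs, rfl⟩
      exact ⟨s, Set.mem_univ s, by simp only [min_eq_left (Set.mem_Iic.mp hs)]⟩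
    · rintro ⟨s, -, rfl⟩
      exact ⟨min s t, Set.mem_Iic.mpr (min_le_right s t), rfl⟩
  rw [h]
  refine IsCompact.continuous_sInf (f := fun t s => β (π (min s t))) isCompact_univ ?_
  exact β.continuous.comp (π.continuous_toFun.comp (continuous_snd.min continuous_fst))

theorem runningInf_zero (β : V →L[ℝ] ℝ) (π : PitmanPath T V) (t : Set.Icc (0 : ℝ) T)
    (ht : (t : ℝ) = 0) : runningInf β π t = 0 := by
  have h : Set.Iic t = {t} := by
    ext s
    simp only [Set.mem_Iic, Set.mem_singleton_iff]
    constructor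
    · intro hs
      refine le_antisymm hs ?_
      have : (t : ℝ) ≤ s := by rw [ht]; exact s.2.1
      exact this
    · rintro rfl
      exact le_rfl
  simp [runningInf, h, π.map_zero t ht]

/-- The Pitman transform of the pair `(a, β)`, where `a` is a root and `β` its coroot:
`(P π)(t) = π(t) - inf_{0 ≤ s ≤ t} β(π(s)) • a`. -/
noncomputable def pitman (a : V) (β : V →L[ℝ] ℝ) (π : PitmanPath T V) : PitmanPath T V where
  toFun t := π t - runningInf β π t • a
  continuous_toFun :=
    π.continuous_toFun.sub ((continuous_runningInf β π).smul continuous_const)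
  map_zero t ht := by rw [runningInf_zero β π t ht, π.map_zero t ht]; simp

/-- The pointwise action of a continuous linear map on paths. -/
def map (f : V →L[ℝ] V) (π : PitmanPath T V) : PitmanPath T V where
  toFun t := f (π t)
  continuous_toFun := f.continuous.comp π.continuous_toFun
  map_zero t ht := by rw [π.map_zero t ht, _root_.map_zero]

/-- The terminal time `T` as a point of `[0, T]`. -/
def endTime (T : ℝ) [hT : Fact (0 < T)] : Set.Icc (0 : ℝ) T :=
  ⟨T, hT.out.le, le_rfl⟩

/-- Time reversal `t ↦ T - t` on `[0, T]`. -/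
def revTime (t : Set.Icc (0 : ℝ) T) : Set.Icc (0 : ℝ) T :=
  ⟨T - t, sub_nonneg.mpr t.2.2, sub_le_self T t.2.1⟩

/-- `(κ π)(t) = π(T - t) - π(T)`. -/
def kappa [Fact (0 < T)] (π : PitmanPath T V) : PitmanPath T V where
  toFun t := π (revTime t) - π (endTime T)
  continuous_toFun :=
    (π.continuous_toFun.comp
      (Continuous.subtype_mk (continuous_const.sub continuous_subtype_val) _)).sub
      continuous_const
  map_zero t ht := by
    have h : revTime t = endTime T := Subtype.ext (by simp [revTime, endTime, ht])
    rw [h, sub_self]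

variable {B : Type*}

/-- `P_{s₁} P_{s₂} ⋯ P_{sₗ} π` for the word `[s₁, …, sₗ]`, for given simple roots `α`
and simple coroots `αv`. -/
noncomputable def pitmanWord (α : B → V) (αv : B → V →L[ℝ] ℝ) (ω : List B)
    (π : PitmanPath T V) : PitmanPath T V :=
  ω.foldr (fun s η => pitman (α s) (αv s) η) π

/-- A path is dominant if all simple coroots are nonnegative along it, i.e. if it stays in the
closed Weyl chamber. -/
def IsDominant (αv : B → V →L[ℝ] ℝ) (π : PitmanPath T V) : Prop :=
  ∀ (s : B) (t : Set.Icc (0 : ℝ) T), 0 ≤ αv s (π t)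

variable {M : CoxeterMatrix B} {W : Subgroup (V ≃L[ℝ] V)}

/-- The operator `P_w = P_{s₁} ⋯ P_{sₗ}`, where `w = s₁ ⋯ sₗ` is a reduced decomposition. The
decomposition is chosen here; that it does not matter for the longest element is part of the
theorem. -/
noncomputable def pitmanOp (cs : CoxeterSystem M W) (α : B → V) (αv : B → V →L[ℝ] ℝ) (w : W)
    (π : PitmanPath T V) : PitmanPath T V :=
  pitmanWord α αv (Classical.choose (cs.exists_isReduced w)) π

/-- The transformation `I = P_{w₀} (-w₀) κ`. -/
noncomputable def dualI [Fact (0 < T)] (cs : CoxeterSystem M W) (α : B → V)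
    (αv : B → V →L[ℝ] ℝ) (w₀ : W) (π : PitmanPath T V) : PitmanPath T V :=
  pitmanOp cs α αv w₀ (map (-((w₀ : V ≃L[ℝ] V) : V →L[ℝ] V)) (kappa π))

end Operators

end PitmanPath

/-- `α` and `αv` are simple roots and simple coroots for the Coxeter system `cs` of the linear
group `W` on `V`: the Coxeter generators act as the reflections `v ↦ v - αv(v) α`, and the pairings
between simple roots and coroots are those of the walls of a Weyl chamber (two walls meet at the
angle `π / m(s, t)`). The roots need not be normalized. -/
structure IsSimpleRootSystem {V : Type*} [AddCommGroup V] [Module ℝ V] [TopologicalSpace V]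
    {B : Type*} {M : CoxeterMatrix B} {W : Subgroup (V ≃L[ℝ] V)} (cs : CoxeterSystem M W)
    (α : B → V) (αv : B → V →L[ℝ] ℝ) : Prop where
  pairing_self : ∀ s, αv s (α s) = 2
  reflection : ∀ s v, (cs.simple s : V ≃L[ℝ] V) v = v - αv s v • α s
  pairing_nonpos : ∀ s t, s ≠ t → αv s (α t) ≤ 0
  pairing_mul : ∀ s t, s ≠ t → αv s (α t) * αv t (α s) = 4 * Real.cos (Real.pi / M s t) ^ 2

set_option linter.unusedSectionVars false

/-! Write P for `pitmanOp` at `w₀`. Everything rests on three relations: P does not depend on the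
reduced word, P κ P_s = P κ, and P commutes with -w₀. The last gives I = P(-w₀)κ = (-w₀)Pκ, hence I²
= PκPκ = Pκκ = P and IP = I. Since `w₀` has a reduced word beginning with any given s, P takes
dominant values, and it fixes dominant paths.

Independence of the word follows from Matsumoto's theorem (`prod_map_eq_of_isReduced`) and the braid
relations. For these, the coefficients of the two roots in an alternating product of Pitman
transforms are nested infima with weights sin(jθ)/sin θ, θ = π/m (`pitmanWord_alternatingWord`). At
length m the last weight vanishes and the formula becomes symmetric in the two roots.

The analytic input, for the braid relations and for time reversal (`pitman_kappa_pitman`) alike, is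
one identity: if m is the running infimum of z, then inf(z - 2m) + m(v) + m(w) = inf z, both infima
over [v, w].

The simple roots in V need not be linearly independent, so signs of roots are read off from a
geometric representation on `B →₀ ℝ`, which maps equivariantly to V. It yields Matsumoto's theorem,
w₀² = 1, and the fact that -w₀ permutes the simple roots up to scaling (`exists_longest_conj`),
hence intertwines the P_s.

For endpoints, each P_s moves a value away from the wall of s in such a way that the old value lies
between the new one and its reflection. So π(T) lies in the convex hull of the W-orbit of the
dominant vector Iπ(T), and Iπ(T) - π(T) lies in the cone of simple roots. For dominant π the same
bound for Iπ, with I²π = π, gives the opposite sign, and the cone is pointed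
(`eq_of_sub_mem_rootCone`). The general case follows from I = IP. -/

/-- The running infimum of a real function. -/
noncomputable def runInf {ι : Type*} [Preorder ι] (f : ι → ℝ) (t : ι) : ℝ :=
  sInf (f '' Set.Iic t)

/-! ### Running infima and nested infima of continuous functions. -/

section RunInf

variable {T : ℝ}

theorem isLeast_runInf {f : Set.Icc (0 : ℝ) T → ℝ} (hf : Continuous f) (t : Set.Icc (0 : ℝ) T) :
    IsLeast (f '' Set.Iic t) (runInf f t) :=
  (isClosed_Iic.isCompact.image hf).isLeast_sInf ⟨f t, t, Set.mem_Iic.mpr le_rfl, rfl⟩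

theorem runInf_le {f : Set.Icc (0 : ℝ) T → ℝ} (hf : Continuous f) {s t : Set.Icc (0 : ℝ) T}
    (h : s ≤ t) : runInf f t ≤ f s :=
  (isLeast_runInf hf t).2 ⟨s, h, rfl⟩

theorem exists_eq_runInf {f : Set.Icc (0 : ℝ) T → ℝ} (hf : Continuous f) (t : Set.Icc (0 : ℝ) T) :
    ∃ s ≤ t, f s = runInf f t := by
  obtain ⟨s, hs, h⟩ := (isLeast_runInf hf t).1
  exact ⟨s, hs, h⟩

theorem le_runInf {f : Set.Icc (0 : ℝ) T → ℝ} (hf : Continuous f) {t : Set.Icc (0 : ℝ) T} {x : ℝ}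
    (h : ∀ s ≤ t, x ≤ f s) : x ≤ runInf f t := by
  obtain ⟨s, hs, e⟩ := exists_eq_runInf hf t
  exact e ▸ h s hs

theorem runInf_antitone {f : Set.Icc (0 : ℝ) T → ℝ} (hf : Continuous f) : Antitone (runInf f) :=
  fun _ _ h => le_runInf hf fun _ hr => runInf_le hf (hr.trans h)

theorem continuous_runInf {f : Set.Icc (0 : ℝ) T → ℝ} (hf : Continuous f) :
    Continuous (runInf f) := by
  have h : runInf f = fun t => sInf ((fun s => f (min s t)) '' Set.univ) := by
    funext t
    unfold runInf
    congr 1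
    ext x
    constructor
    · rintro ⟨s, hs, rfl⟩
      exact ⟨s, Set.mem_univ s, by simp only [min_eq_left (Set.mem_Iic.mp hs)]⟩
    · rintro ⟨s, -, rfl⟩
      exact ⟨min s t, Set.mem_Iic.mpr (min_le_right s t), rfl⟩
  rw [h]
  exact IsCompact.continuous_sInf (f := fun t s => f (min s t)) isCompact_univ
    (hf.comp (continuous_snd.min continuous_fst))

theorem runInf_eq_of_forall {f : Set.Icc (0 : ℝ) T → ℝ} (hf : Continuous f)
    {t : Set.Icc (0 : ℝ) T} {x : ℝ} (h : ∀ s ≤ t, x ≤ f s) (h' : ∃ s ≤ t, f s ≤ x) :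
    runInf f t = x := by
  obtain ⟨s, hs, e⟩ := h'
  exact le_antisymm ((runInf_le hf hs).trans e) (le_runInf hf h)

theorem runInf_const_mul {f : Set.Icc (0 : ℝ) T → ℝ} (hf : Continuous f) {c : ℝ} (hc : 0 ≤ c)
    (t : Set.Icc (0 : ℝ) T) : runInf (fun s => c * f s) t = c * runInf f t := by
  refine runInf_eq_of_forall (by fun_prop)
    (fun s hs => mul_le_mul_of_nonneg_left (runInf_le hf hs) hc) ?_
  obtain ⟨s, hs, e⟩ := exists_eq_runInf hf t
  exact ⟨s, hs, by rw [e]⟩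

theorem isPreconnected_Icc_subtype (v w : Set.Icc (0 : ℝ) T) : IsPreconnected (Set.Icc v w) := by
  rw [← Topology.IsInducing.subtypeVal.isPreconnected_image]
  have : Subtype.val '' Set.Icc v w = Set.Icc (v : ℝ) w := by
    ext x
    constructor
    · rintro ⟨y, hy, rfl⟩
      exact hy
    · intro hx
      exact ⟨⟨x, v.2.1.trans hx.1, hx.2.trans w.2.2⟩, hx, rfl⟩
  rw [this]
  exact isPreconnected_Icc

/-- The running infimum of `z` takes its value at `v` at a later point where `z` agrees with it,
if it drops after `v`. -/
theorem exists_eq_runInf_of_lt {z : Set.Icc (0 : ℝ) T → ℝ} (hz : Continuous z)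
    {v w : Set.Icc (0 : ℝ) T} (h : runInf z w < runInf z v) :
    ∃ u, v ≤ u ∧ u ≤ w ∧ z u = runInf z v ∧ runInf z u = runInf z v := by
  obtain ⟨r, hr, er⟩ := exists_eq_runInf hz w
  have hvr : v ≤ r := by
    by_contra hlt
    have := runInf_le hz (not_le.mp hlt).le
    linarith
  have hcl : IsClosed (Set.Icc v w ∩ {u | z u ≤ runInf z v}) :=
    isClosed_Icc.inter (isClosed_le hz continuous_const)
  -- The witness is the first time u after v at which z has come down to its infimum up to v; the
  -- intermediate value theorem excludes a jump below that level.
  obtain ⟨u, ⟨⟨hvu, huw⟩, hu⟩, hmin⟩ := hcl.isCompact.exists_isLeast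
    ⟨r, ⟨hvr, hr⟩, show z r ≤ runInf z v by rw [er]; exact h.le⟩
  have hlow : runInf z v ≤ z u := by
    by_contra hlt
    rw [not_le] at hlt
    have hv := runInf_le hz (le_refl v)
    obtain ⟨u', ⟨h1, h2⟩, h3⟩ := (isPreconnected_Icc_subtype v u).intermediate_value
      (Set.right_mem_Icc.mpr hvu) (Set.left_mem_Icc.mpr hvu) hz.continuousOn ⟨hlt.le, hv⟩
    have : u ≤ u' := hmin ⟨⟨h1, h2.trans huw⟩, h3.le⟩
    have : u = u' := le_antisymm this h2
    subst this
    linarith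
  refine ⟨u, hvu, huw, le_antisymm hu hlow, le_antisymm (runInf_antitone hz hvu) ?_⟩
  refine le_runInf hz fun s hs => ?_
  rcases le_total s v with hsv | hvs
  · exact runInf_le hz hsv
  · by_contra hlt
    rw [not_le] at hlt
    have : u ≤ s := hmin ⟨⟨hvs, hs.trans huw⟩, hlt.le⟩
    have : u = s := le_antisymm this hs
    subst this
    linarith

/-- With `exists_le_sub_two_runInf`, this is inf(z - 2m) + m(v) + m(w) = inf z over [v, w], where m
is the running infimum. If m drops after v, then at the first passage u of the level m(v) one has z
- 2m = -m(v), so the left side is at most m(w). -/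
theorem exists_sub_two_runInf_le {z : Set.Icc (0 : ℝ) T → ℝ} (hz : Continuous z)
    {v s w : Set.Icc (0 : ℝ) T} (hvs : v ≤ s) (hsw : s ≤ w) :
    ∃ u, v ≤ u ∧ u ≤ w ∧ z u - 2 * runInf z u + runInf z v + runInf z w ≤ z s := by
  rcases (runInf_antitone hz (hvs.trans hsw)).eq_or_lt with h | h
  · refine ⟨s, hvs, hsw, ?_⟩
    have h1 := runInf_antitone hz hvs
    have h2 := runInf_antitone hz hsw
    linarith
  · obtain ⟨u, hvu, huw, e1, e2⟩ := exists_eq_runInf_of_lt hz h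
    exact ⟨u, hvu, huw, by rw [e1, e2]; linarith [runInf_le hz hsw]⟩

theorem exists_le_sub_two_runInf {z : Set.Icc (0 : ℝ) T → ℝ} (hz : Continuous z)
    {v u w : Set.Icc (0 : ℝ) T} (hvu : v ≤ u) (huw : u ≤ w) :
    ∃ s, v ≤ s ∧ s ≤ w ∧ z s ≤ z u - 2 * runInf z u + runInf z v + runInf z w := by
  have h1 := runInf_antitone hz hvu
  have h2 := runInf_antitone hz huw
  rcases (runInf_antitone hz (hvu.trans huw)).eq_or_lt with h | h
  · exact ⟨u, hvu, huw, by linarith⟩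
  · obtain ⟨r, hr, er⟩ := exists_eq_runInf hz w
    have hvr : v ≤ r := by
      by_contra hlt
      have := runInf_le hz (not_le.mp hlt).le
      linarith
    exact ⟨r, hvr, hr, by linarith [runInf_le hz (le_refl u)]⟩

/-- For a fixed inner time r, this is c times the identity for inf(z - 2m) on the window [r, t]. -/
theorem runInf_nested {z e : Set.Icc (0 : ℝ) T → ℝ} (hz : Continuous z) (he : Continuous e)
    {c : ℝ} (hc : 0 ≤ c) (t : Set.Icc (0 : ℝ) T) :
    runInf (fun s => c * (z s - 2 * runInf z s) + runInf (fun r => e r + c * runInf z r) s) t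
      + c * runInf z t = runInf (fun s => c * z s + runInf e s) t := by
  have hm := continuous_runInf hz
  have he' := continuous_runInf he
  have hE : Continuous fun r => e r + c * runInf z r := by fun_prop
  have hE' := continuous_runInf hE
  rw [← eq_sub_iff_add_eq]
  refine runInf_eq_of_forall (by fun_prop) (fun s hs => ?_) ?_
  · obtain ⟨r, hr, er⟩ := exists_eq_runInf hE s
    obtain ⟨q, hrq, hqt, h⟩ := exists_le_sub_two_runInf hz hr hs
    have h1 : runInf (fun s => c * z s + runInf e s) t ≤ c * z q + runInf e q :=
      runInf_le (f := fun s => c * z s + runInf e s) (by fun_prop) hqt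
    have h2 := runInf_le he hrq
    have h3 := mul_le_mul_of_nonneg_left h hc
    rw [← er]
    linarith
  · obtain ⟨s, hs, es⟩ := exists_eq_runInf (f := fun s => c * z s + runInf e s) (by fun_prop) t
    obtain ⟨r, hr, er⟩ := exists_eq_runInf he s
    obtain ⟨q, hrq, hqt, h⟩ := exists_sub_two_runInf_le hz hr hs
    refine ⟨q, hqt, ?_⟩
    have h2 := runInf_le hE hrq
    have h3 := mul_le_mul_of_nonneg_left h hc
    rw [← es, ← er]
    linarith

/-- The nested infimum
`inf_{t ≥ s₀ ≥ ⋯ ≥ s_{n-1}} (u_j f(s₀) + u_{j+1} g(s₁) + u_{j+2} f(s₂) + ⋯)`. -/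
noncomputable def chainInf (u : ℕ → ℝ) :
    ℕ → ℕ → (Set.Icc (0 : ℝ) T → ℝ) → (Set.Icc (0 : ℝ) T → ℝ) → Set.Icc (0 : ℝ) T → ℝ
  | 0, _, _, _ => fun _ => 0
  | n + 1, j, f, g => runInf fun s => u j * f s + chainInf u n (j + 1) g f s

theorem continuous_chainInf (u : ℕ → ℝ) (n j : ℕ) {f g : Set.Icc (0 : ℝ) T → ℝ}
    (hf : Continuous f) (hg : Continuous g) : Continuous (chainInf u n j f g) := by
  induction n generalizing j f g with
  | zero => exact continuous_const
  | succ n ih =>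
    have := ih (j + 1) hg hf
    exact continuous_runInf (by fun_prop)

theorem chainInf_succ_of_eq_zero (u : ℕ → ℝ) (n j : ℕ) (f g : Set.Icc (0 : ℝ) T → ℝ)
    (h : u (j + n) = 0) : chainInf u (n + 1) j f g = chainInf u n j f g := by
  induction n generalizing j f g with
  | zero =>
    funext t
    have h0 : u j = 0 := h
    simp only [chainInf, h0, zero_mul, add_zero]
    exact runInf_eq_of_forall continuous_const (fun _ _ => le_rfl) ⟨t, le_rfl, le_rfl⟩
  | succ n ih =>
    rw [chainInf, ih (j + 1) g f (by rw [← h]; congr 1; omega)]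
    rfl

/-- The effect on a nested infimum of replacing π by P_sπ, when the outermost function is the coroot
of s. Each inductive step absorbs two levels by `runInf_nested` and uses c u(j+1) - u(j+2) = u(j).
-/
theorem chainInf_even_add {u : ℕ → ℝ} {c : ℝ} (hu : ∀ j, u (j + 2) = c * u (j + 1) - u j)
    {z y : Set.Icc (0 : ℝ) T → ℝ} (hz : Continuous z) (hy : Continuous y) (k j : ℕ)
    (h0 : ∀ i ≤ 2 * k, 0 ≤ u (j + i)) (t : Set.Icc (0 : ℝ) T) :
    chainInf u (2 * k) j (fun s => z s - 2 * runInf z s) (fun s => y s + c * runInf z s) t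
      + u j * runInf z t = chainInf u (2 * k + 1) j z y t := by
  induction k generalizing j t with
  | zero =>
    simp only [chainInf, add_zero, zero_add]
    exact (runInf_const_mul hz (h0 0 le_rfl) t).symm
  | succ k ih =>
    have ih' := ih (j + 2) (fun i hi => by
      have := h0 (i + 2) (by omega)
      rwa [add_comm i 2, ← add_assoc] at this)
    have hcont := continuous_chainInf u (2 * k + 1) (j + 2) hz hy
    have key := runInf_nested (e := fun s => u (j + 1) * y s + chainInf u (2 * k + 1) (j + 2) z y s)
      hz (by fun_prop) (h0 0 (by omega)) t
    rw [show 2 * (k + 1) = 2 * k + 1 + 1 by ring]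
    rw [chainInf, chainInf]
    rw [chainInf, chainInf]
    rw [add_zero] at key
    rw [← key]
    congr 2
    funext s
    congr 2
    funext r
    rw [← ih', hu j]
    ring

/-- When the outermost coroot is the other one, no boundary term remains: the outer level
contributes c u(1), which equals u(2) because u(0) = 0. -/
theorem chainInf_odd_eq {u : ℕ → ℝ} {c : ℝ} (hu : ∀ j, u (j + 2) = c * u (j + 1) - u j)
    (hu0 : u 0 = 0) {z y : Set.Icc (0 : ℝ) T → ℝ} (hz : Continuous z) (hy : Continuous y) (k : ℕ)
    (h0 : ∀ i ≤ 2 * k, 0 ≤ u (2 + i)) :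
    chainInf u (2 * k + 1) 1 (fun s => y s + c * runInf z s) (fun s => z s - 2 * runInf z s)
      = chainInf u (2 * k + 2) 1 y z := by
  rw [chainInf, chainInf]
  congr 1
  funext s
  rw [← chainInf_even_add hu hz hy k 2 h0 s, show u 2 = c * u 1 - u 0 from hu 0, hu0]
  ring

end RunInf

/-! ### Braid relations for Pitman transforms. -/

namespace PitmanPath

section Braid

variable {T : ℝ} {V : Type*} [AddCommGroup V] [Module ℝ V] [TopologicalSpace V]
  [IsTopologicalAddGroup V] [ContinuousSMul ℝ V]

theorem continuous_coroot (β : V →L[ℝ] ℝ) (π : PitmanPath T V) : Continuous fun t => β (π t) :=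
  β.continuous.comp π.continuous_toFun

theorem pitman_apply (a : V) (β : V →L[ℝ] ℝ) (π : PitmanPath T V) (t : Set.Icc (0 : ℝ) T) :
    pitman a β π t = π t - runInf (fun s => β (π s)) t • a :=
  rfl

theorem pitman_smul_inv_smul (a : V) (β : V →L[ℝ] ℝ) {c : ℝ} (hc : 0 < c) (π : PitmanPath T V) :
    pitman (c • a) (c⁻¹ • β) π = pitman a β π := by
  ext t
  rw [pitman_apply, pitman_apply]
  have : runInf (fun s => (c⁻¹ • β) (π s)) t = c⁻¹ * runInf (fun s => β (π s)) t :=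
    runInf_const_mul (continuous_coroot β π) (inv_nonneg.mpr hc.le) t
  rw [this, smul_smul, mul_right_comm, inv_mul_cancel₀ hc.ne', one_mul]

variable {B : Type*}

@[simp]
theorem pitmanWord_nil (α : B → V) (αv : B → V →L[ℝ] ℝ) (π : PitmanPath T V) :
    pitmanWord α αv [] π = π :=
  rfl

theorem pitmanWord_cons (α : B → V) (αv : B → V →L[ℝ] ℝ) (s : B) (ω : List B)
    (π : PitmanPath T V) :
    pitmanWord α αv (s :: ω) π = pitman (α s) (αv s) (pitmanWord α αv ω π) :=
  rfl

theorem pitmanWord_append (α : B → V) (αv : B → V →L[ℝ] ℝ) (ω ω' : List B)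
    (π : PitmanPath T V) :
    pitmanWord α αv (ω ++ ω') π = pitmanWord α αv ω (pitmanWord α αv ω' π) := by
  simp [pitmanWord]

theorem pitmanWord_concat (α : B → V) (αv : B → V →L[ℝ] ℝ) (s : B) (ω : List B)
    (π : PitmanPath T V) :
    pitmanWord α αv (ω.concat s) π = pitmanWord α αv ω (pitman (α s) (αv s) π) := by
  rw [List.concat_eq_append, pitmanWord_append]
  rfl

theorem pitmanWord_smul_inv_smul (α : B → V) (αv : B → V →L[ℝ] ℝ) {c : B → ℝ}
    (hc : ∀ s, 0 < c s) (ω : List B) (π : PitmanPath T V) :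
    pitmanWord (fun s => c s • α s) (fun s => (c s)⁻¹ • αv s) ω π = pitmanWord α αv ω π := by
  induction ω with
  | nil => rfl
  | cons s ω ih => rw [pitmanWord_cons, pitmanWord_cons, ih, pitman_smul_inv_smul _ _ (hc s)]

theorem coroot_pitman_self {a : V} {β : V →L[ℝ] ℝ} (h : β a = 2) (π : PitmanPath T V) :
    (fun t => β (pitman a β π t)) =
      fun t => β (π t) - 2 * runInf (fun s => β (π s)) t := by
  funext t
  rw [pitman_apply, map_sub, map_smul, h, smul_eq_mul, mul_comm]

theorem coroot_pitman_of_eq_neg {a : V} {β γ : V →L[ℝ] ℝ} {c : ℝ} (h : γ a = -c)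
    (π : PitmanPath T V) :
    (fun t => γ (pitman a β π t)) =
      fun t => γ (π t) + c * runInf (fun s => β (π s)) t := by
  funext t
  rw [pitman_apply, map_sub, map_smul, h, smul_eq_mul]
  ring

/-- Lengthening the word by a last letter replaces π by a Pitman transform of π, which the two
nested infimum lemmas reabsorb. The two parities are proved together, for both orders of i and j,
since each length uses the previous one with i and j exchanged. -/
theorem pitmanWord_alternatingWord {α : B → V} {αv : B → V →L[ℝ] ℝ} {u : ℕ → ℝ} {c : ℝ}
    (hu : ∀ j, u (j + 2) = c * u (j + 1) - u j) (hu0 : u 0 = 0) (hu1 : u 1 = 1) (k : ℕ) :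
    ∀ i j : B, αv i (α i) = 2 → αv j (α j) = 2 → αv i (α j) = -c → αv j (α i) = -c →
      ((∀ l ≤ 2 * k + 1, 0 ≤ u l) → ∀ (π : PitmanPath T V) (t : Set.Icc (0 : ℝ) T),
        pitmanWord α αv (CoxeterSystem.alternatingWord i j (2 * k + 1)) π t =
          π t - chainInf u (2 * k + 1) 1 (fun s => αv j (π s)) (fun s => αv i (π s)) t • α j
            - chainInf u (2 * k) 1 (fun s => αv i (π s)) (fun s => αv j (π s)) t • α i) ∧
      ((∀ l ≤ 2 * k + 2, 0 ≤ u l) → ∀ (π : PitmanPath T V) (t : Set.Icc (0 : ℝ) T),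
        pitmanWord α αv (CoxeterSystem.alternatingWord i j (2 * k + 2)) π t =
          π t - chainInf u (2 * k + 2) 1 (fun s => αv i (π s)) (fun s => αv j (π s)) t • α i
            - chainInf u (2 * k + 1) 1 (fun s => αv j (π s)) (fun s => αv i (π s)) t • α j) := by
  have step : ∀ k (i j : B), αv i (α i) = 2 → αv j (α j) = 2 → αv i (α j) = -c →
      αv j (α i) = -c →
      ((∀ l ≤ 2 * k + 1, 0 ≤ u l) → ∀ (π : PitmanPath T V) (t : Set.Icc (0 : ℝ) T),
        pitmanWord α αv (CoxeterSystem.alternatingWord j i (2 * k + 1)) π t =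
          π t - chainInf u (2 * k + 1) 1 (fun s => αv i (π s)) (fun s => αv j (π s)) t • α i
            - chainInf u (2 * k) 1 (fun s => αv j (π s)) (fun s => αv i (π s)) t • α j) →
      ((∀ l ≤ 2 * k + 2, 0 ≤ u l) → ∀ (π : PitmanPath T V) (t : Set.Icc (0 : ℝ) T),
        pitmanWord α αv (CoxeterSystem.alternatingWord i j (2 * k + 2)) π t =
          π t - chainInf u (2 * k + 2) 1 (fun s => αv i (π s)) (fun s => αv j (π s)) t • α i
            - chainInf u (2 * k + 1) 1 (fun s => αv j (π s)) (fun s => αv i (π s)) t • α j) := by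
    intro k i j hi hj hij hji ih hl π t
    rw [CoxeterSystem.alternatingWord_succ, pitmanWord_concat, ih (fun l h => hl l (by omega)),
      coroot_pitman_self hj, coroot_pitman_of_eq_neg hij,
      chainInf_odd_eq hu hu0 (continuous_coroot _ π) (continuous_coroot _ π) k
        (fun l h => hl _ (by omega)),
      ← chainInf_even_add hu (continuous_coroot _ π) (continuous_coroot _ π) k 1
        (fun l h => hl _ (by omega)) t, pitman_apply, hu1]
    module
  induction k with
  | zero =>
    intro i j hi hj hij hji
    have base : ∀ (i j : B), (∀ l ≤ 2 * 0 + 1, 0 ≤ u l) → ∀ (π : PitmanPath T V)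
        (t : Set.Icc (0 : ℝ) T),
        pitmanWord α αv (CoxeterSystem.alternatingWord i j (2 * 0 + 1)) π t =
          π t - chainInf u (2 * 0 + 1) 1 (fun s => αv j (π s)) (fun s => αv i (π s)) t • α j
            - chainInf u (2 * 0) 1 (fun s => αv i (π s)) (fun s => αv j (π s)) t • α i := by
      intro i j _ π t
      simp [CoxeterSystem.alternatingWord, pitmanWord_cons, chainInf, hu1, pitman_apply]
    exact ⟨base i j, step 0 i j hi hj hij hji (base j i)⟩
  | succ k ih =>
    intro i j hi hj hij hji
    have odd : ∀ (i j : B), αv i (α i) = 2 → αv j (α j) = 2 → αv i (α j) = -c →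
        αv j (α i) = -c → (∀ l ≤ 2 * (k + 1) + 1, 0 ≤ u l) → ∀ (π : PitmanPath T V)
        (t : Set.Icc (0 : ℝ) T),
        pitmanWord α αv (CoxeterSystem.alternatingWord i j (2 * (k + 1) + 1)) π t =
          π t - chainInf u (2 * (k + 1) + 1) 1 (fun s => αv j (π s)) (fun s => αv i (π s)) t • α j
            - chainInf u (2 * (k + 1)) 1 (fun s => αv i (π s)) (fun s => αv j (π s)) t • α i := by
      intro i j hi hj hij hji hl π t
      rw [CoxeterSystem.alternatingWord_succ, pitmanWord_concat,
        show 2 * (k + 1) = 2 * k + 2 by ring,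
        (ih j i hj hi hji hij).2 (fun l h => hl l (by omega)),
        coroot_pitman_self hj, coroot_pitman_of_eq_neg hij,
        chainInf_odd_eq hu hu0 (continuous_coroot _ π) (continuous_coroot _ π) k
          (fun l h => hl _ (by omega)), show 2 * k + 2 = 2 * (k + 1) by ring,
        ← chainInf_even_add hu (continuous_coroot _ π) (continuous_coroot _ π) (k + 1) 1
          (fun l h => hl _ (by omega)) t, pitman_apply, hu1]
      module
    exact ⟨odd i j hi hj hij hji, step (k + 1) i j hi hj hij hji (odd j i hj hi hji hij)⟩

theorem pitmanWord_alternatingWord_comm {α : B → V} {αv : B → V →L[ℝ] ℝ} {u : ℕ → ℝ} {c : ℝ}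
    (hu : ∀ j, u (j + 2) = c * u (j + 1) - u j) (hu0 : u 0 = 0) (hu1 : u 1 = 1) {m : ℕ}
    (hm : 1 ≤ m) (hl : ∀ l ≤ m, 0 ≤ u l) (hum : u m = 0) {i j : B} (hi : αv i (α i) = 2)
    (hj : αv j (α j) = 2) (hij : αv i (α j) = -c) (hji : αv j (α i) = -c) (π : PitmanPath T V) :
    pitmanWord α αv (CoxeterSystem.alternatingWord i j m) π =
      pitmanWord α αv (CoxeterSystem.alternatingWord j i m) π := by
  ext t
  obtain ⟨k, rfl | rfl⟩ : ∃ k, m = 2 * k + 1 ∨ m = 2 * k + 2 := ⟨(m - 1) / 2, by omega⟩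
  · rw [(pitmanWord_alternatingWord hu hu0 hu1 k i j hi hj hij hji).1 hl,
      (pitmanWord_alternatingWord hu hu0 hu1 k j i hj hi hji hij).1 hl,
      chainInf_succ_of_eq_zero _ _ _ _ _ (by rwa [add_comm]),
      chainInf_succ_of_eq_zero _ _ _ _ _ (by rwa [add_comm])]
    abel
  · rw [(pitmanWord_alternatingWord hu hu0 hu1 k i j hi hj hij hji).2 hl,
      (pitmanWord_alternatingWord hu hu0 hu1 k j i hj hi hji hij).2 hl,
      chainInf_succ_of_eq_zero u (2 * k + 1) _ _ _ (by rw [← hum]; congr 1; omega),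
      chainInf_succ_of_eq_zero u (2 * k + 1) _ _ _ (by rw [← hum]; congr 1; omega)]
    abel

end Braid

end PitmanPath

/-! ### The weights sin(jθ)/sin θ. -/

/-- The numbers `sin (j θ) / sin θ` with `θ = π / m`. -/
noncomputable def sinRatio (m j : ℕ) : ℝ :=
  Real.sin (j * (Real.pi / m)) / Real.sin (Real.pi / m)

section SinRatio

variable {m : ℕ}

theorem sin_pi_div_pos (hm : 2 ≤ m) : 0 < Real.sin (Real.pi / m) := by
  have : (2 : ℝ) ≤ m := by exact_mod_cast hm
  refine Real.sin_pos_of_pos_of_lt_pi (by positivity) ?_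
  exact div_lt_self Real.pi_pos (by linarith)

theorem sinRatio_zero : sinRatio m 0 = 0 := by simp [sinRatio]

theorem sinRatio_one (hm : 2 ≤ m) : sinRatio m 1 = 1 := by
  simp [sinRatio, (sin_pi_div_pos hm).ne']

theorem sinRatio_add_two (j : ℕ) :
    sinRatio m (j + 2) = 2 * Real.cos (Real.pi / m) * sinRatio m (j + 1) - sinRatio m j := by
  unfold sinRatio
  push_cast
  generalize Real.pi / m = θ
  rw [mul_div_assoc', ← sub_div]
  congr 1
  rw [show ((j : ℝ) + 2) * θ = (j + 1) * θ + θ by ring, show (j : ℝ) * θ = (j + 1) * θ - θ by ring,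
    Real.sin_add, Real.sin_sub]
  ring

theorem sinRatio_self (hm : 2 ≤ m) : sinRatio m m = 0 := by
  have : (m : ℝ) ≠ 0 := by positivity
  simp [sinRatio, mul_div_cancel₀ _ this]

theorem sinRatio_nonneg (hm : 2 ≤ m) {j : ℕ} (hj : j ≤ m) : 0 ≤ sinRatio m j := by
  refine div_nonneg (Real.sin_nonneg_of_nonneg_of_le_pi (by positivity) ?_) (sin_pi_div_pos hm).le
  have h0 : (0 : ℝ) < m := by positivity
  have : (j : ℝ) ≤ m := by exact_mod_cast hj
  calc (j : ℝ) * (Real.pi / m) ≤ m * (Real.pi / m) := by gcongr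
    _ = Real.pi := mul_div_cancel₀ _ h0.ne'

theorem sinRatio_two_mul (hm : 2 ≤ m) : sinRatio m (2 * m) = 0 := by
  have : (m : ℝ) ≠ 0 := by positivity
  simp [sinRatio, mul_assoc, mul_div_cancel₀ _ this]

theorem sinRatio_two_mul_add_one (hm : 2 ≤ m) : sinRatio m (2 * m + 1) = 1 := by
  have : (m : ℝ) ≠ 0 := by positivity
  have h : ((2 * m + 1 : ℕ) : ℝ) * (Real.pi / m) = Real.pi / m + 2 * Real.pi := by
    push_cast
    field_simp
    ring
  rw [sinRatio, h, Real.sin_add_two_pi, div_self (sin_pi_div_pos hm).ne']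

end SinRatio

/-! ### Products of two reflections. -/

section RankTwo

variable {N : Type*} [AddCommGroup N] [Module ℝ N] {σ τ : Module.End ℝ N} {f g : N} {c : ℝ}
  {u : ℕ → ℝ}

theorem mul_pow_apply_left (hu : ∀ j, u (j + 2) = c * u (j + 1) - u j) (hu0 : u 0 = 0)
    (hu1 : u 1 = 1) (hf : σ f = -f) (hg : σ g = g + c • f) (hf' : τ f = f + c • g)
    (hg' : τ g = -g) (k : ℕ) : ((σ * τ) ^ k) f = u (2 * k + 1) • f + u (2 * k) • g := by
  induction k with
  | zero => simp [hu0, hu1]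
  | succ k ih =>
    rw [pow_succ', Module.End.mul_apply, ih, show 2 * (k + 1) + 1 = 2 * k + 1 + 2 by ring,
      hu (2 * k + 1), show 2 * (k + 1) = 2 * k + 2 by ring, hu (2 * k)]
    simp only [Module.End.mul_apply, map_add, map_smul, hf, hg, hf', hg', map_neg]
    module

theorem mul_pow_apply_right (hu : ∀ j, u (j + 2) = c * u (j + 1) - u j) (hu0 : u 0 = 0)
    (hu1 : u 1 = 1) (hf : σ f = -f) (hg : σ g = g + c • f) (hf' : τ f = f + c • g)
    (hg' : τ g = -g) (k : ℕ) :
    ((σ * τ) ^ (k + 1)) g = -u (2 * k + 1) • g - u (2 * k + 2) • f := by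
  induction k with
  | zero =>
    simp only [zero_add, pow_one, mul_zero, hu 0, hu1, hu0, Module.End.mul_apply, hg', map_neg, hg]
    module
  | succ k ih =>
    rw [pow_succ', Module.End.mul_apply, ih, show 2 * (k + 1) + 2 = 2 * k + 2 + 2 by ring,
      show 2 * (k + 1) + 1 = 2 * k + 1 + 2 by ring, hu (2 * k + 2), hu (2 * k + 1)]
    simp only [Module.End.mul_apply, map_sub, map_add, map_smul, hf, hg, hf', hg', map_neg]
    module

/-- On the span of f and g the power is computed by the weights, which have period 2m. The
complement is the common kernel of φ and ψ, where both reflections act trivially; it is a complement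
because the determinant 4 - c² = 4 sin²(π/m) is nonzero. -/
theorem mul_pow_eq_one_of_reflections {φ ψ : N →ₗ[ℝ] ℝ} {m : ℕ} (hm : 2 ≤ m)
    (hσ : ∀ v, σ v = v - φ v • f) (hτ : ∀ v, τ v = v - ψ v • g) (hφf : φ f = 2) (hψg : ψ g = 2)
    (hφg : φ g = -(2 * Real.cos (Real.pi / m))) (hψf : ψ f = -(2 * Real.cos (Real.pi / m))) :
    (σ * τ) ^ m = 1 := by
  have hu := sinRatio_add_two (m := m)
  have hsin := sin_pi_div_pos hm
  have hsq := Real.sin_sq_add_cos_sq (Real.pi / m)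
  set c := 2 * Real.cos (Real.pi / m) with hc
  have hd : 4 - c ^ 2 ≠ 0 := by
    have : 4 - c ^ 2 = 4 * Real.sin (Real.pi / m) ^ 2 := by rw [hc]; linear_combination -4 * hsq
    rw [this]
    positivity
  have h1 : σ f = -f := by rw [hσ, hφf]; module
  have h2 : σ g = g + c • f := by rw [hσ, hφg]; module
  have h3 : τ f = f + c • g := by rw [hτ, hψf]; module
  have h4 : τ g = -g := by rw [hτ, hψg]; module
  have hf : ((σ * τ) ^ m) f = f := by
    rw [mul_pow_apply_left hu sinRatio_zero (sinRatio_one hm) h1 h2 h3 h4,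
      sinRatio_two_mul_add_one hm, sinRatio_two_mul hm]
    module
  have hg : ((σ * τ) ^ m) g = g := by
    obtain ⟨k, rfl⟩ : ∃ k, m = k + 1 := ⟨m - 1, by omega⟩
    have e1 := sinRatio_two_mul hm
    have e2 := sinRatio_two_mul_add_one hm
    have e3 := hu (2 * k + 1)
    rw [show 2 * k + 1 + 2 = 2 * (k + 1) + 1 by ring, e2,
      show 2 * k + 1 + 1 = 2 * (k + 1) by ring, e1] at e3
    rw [mul_pow_apply_right hu sinRatio_zero (sinRatio_one hm) h1 h2 h3 h4,
      show 2 * k + 2 = 2 * (k + 1) by ring, e1,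
      show sinRatio (k + 1) (2 * k + 1) = -1 by linarith]
    module
  ext v
  -- Cramer's rule for the coefficients of the projection of v to the span of f and g.
  obtain ⟨p, q, hp, hq⟩ : ∃ p q, φ v = 2 * p - c * q ∧ ψ v = 2 * q - c * p := by
    refine ⟨(2 * φ v + c * ψ v) / (4 - c ^ 2), (2 * ψ v + c * φ v) / (4 - c ^ 2), ?_, ?_⟩ <;>
    · field_simp
      ring
  obtain ⟨v₀, rfl⟩ : ∃ v₀, v = v₀ + p • f + q • g := ⟨v - p • f - q • g, by abel⟩
  have hφ : φ v₀ = 0 := by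
    simp only [map_add, map_smul, smul_eq_mul, hφf, hφg] at hp
    linarith
  have hψ : ψ v₀ = 0 := by
    simp only [map_add, map_smul, smul_eq_mul, hψf, hψg] at hq
    linarith
  have h0 : (σ * τ) v₀ = v₀ := by
    rw [Module.End.mul_apply, hτ, hψ, zero_smul, sub_zero, hσ, hφ, zero_smul, sub_zero]
  have h0' : ((σ * τ) ^ m) v₀ = v₀ := by
    have : ∀ k, ((σ * τ) ^ k) v₀ = v₀ := fun k => by
      induction k with
      | zero => rfl
      | succ k ih => rw [pow_succ', Module.End.mul_apply, ih, h0]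
    exact this m
  simp only [map_add, map_smul, h0', hf, hg, Module.End.one_apply]

end RankTwo

/-! ### The geometric representation and Matsumoto's theorem. -/

/-- `A` is a generalized Cartan matrix for the Coxeter matrix `M`. -/
structure IsCartanMatrix {B : Type*} (M : CoxeterMatrix B) (A : B → B → ℝ) : Prop where
  diag : ∀ s, A s s = 2
  exists_scale : ∀ s t, s ≠ t → ∃ k : ℝ, 0 < k ∧ A s t = -(2 * Real.cos (Real.pi / M s t)) * k ∧
    A t s = -(2 * Real.cos (Real.pi / M s t)) * k⁻¹

/-- The reflection `v ↦ v - ⟨A_s, v⟩ e_s` of the geometric representation. -/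
noncomputable def cartanReflection {B : Type*} (A : B → B → ℝ) (s : B) : Module.End ℝ (B →₀ ℝ) :=
  LinearMap.id - (Finsupp.linearCombination ℝ (A s)).smulRight (Finsupp.single s 1)

section GeometricRepresentation

variable {B : Type*} {M : CoxeterMatrix B} {A : B → B → ℝ}

theorem cartanReflection_apply (s : B) (v : B →₀ ℝ) :
    cartanReflection A s v =
      v - Finsupp.linearCombination ℝ (A s) v • Finsupp.single s 1 :=
  rfl

theorem linearCombination_single_one (s t : B) :
    Finsupp.linearCombination ℝ (A s) (Finsupp.single t 1) = A s t := by
  simp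

namespace IsCartanMatrix

theorem cartanReflection_single (hA : IsCartanMatrix M A) (s : B) :
    cartanReflection A s (Finsupp.single s 1) = -Finsupp.single s 1 := by
  rw [cartanReflection_apply, linearCombination_single_one, hA.diag]
  module

theorem cartanReflection_sq (hA : IsCartanMatrix M A) (s : B) :
    cartanReflection A s * cartanReflection A s = 1 := by
  refine LinearMap.ext fun v => ?_
  rw [Module.End.mul_apply, cartanReflection_apply s v, map_sub, map_smul,
    hA.cartanReflection_single, cartanReflection_apply, Module.End.one_apply]
  module

theorem isLiftable (hA : IsCartanMatrix M A) : M.IsLiftable (cartanReflection A) := by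
  intro s t
  rcases eq_or_ne s t with rfl | hst
  · rw [hA.cartanReflection_sq, one_pow]
  by_cases h0 : M s t = 0
  · rw [h0, pow_zero]
  have hm : 2 ≤ M s t := by
    have := M.off_diagonal s t hst
    omega
  obtain ⟨k, hk, h1, h2⟩ := hA.exists_scale s t hst
  refine mul_pow_eq_one_of_reflections (f := Finsupp.single s 1) (g := k⁻¹ • Finsupp.single t 1)
    (φ := Finsupp.linearCombination ℝ (A s)) (ψ := k • Finsupp.linearCombination ℝ (A t)) hm
    (cartanReflection_apply s) (fun v => ?_) ?_ ?_ ?_ ?_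
  · rw [cartanReflection_apply, LinearMap.smul_apply, smul_smul, smul_eq_mul, mul_right_comm,
      mul_inv_cancel₀ hk.ne', one_mul]
  · rw [linearCombination_single_one, hA.diag]
  · rw [map_smul, LinearMap.smul_apply, linearCombination_single_one, hA.diag, smul_eq_mul,
      smul_eq_mul, inv_mul_cancel_left₀ hk.ne']
  · rw [map_smul, linearCombination_single_one, h1, smul_eq_mul]
    field_simp
  · rw [LinearMap.smul_apply, linearCombination_single_one, h2, smul_eq_mul]
    field_simp

end IsCartanMatrix

variable {G : Type*} [Group G] (cs : CoxeterSystem M G)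

/-- The geometric representation attached to a generalized Cartan matrix. -/
noncomputable def geomRep (hA : IsCartanMatrix M A) : G →* Module.End ℝ (B →₀ ℝ) :=
  cs.lift ⟨cartanReflection A, hA.isLiftable⟩

@[simp]
theorem geomRep_simple (hA : IsCartanMatrix M A) (s : B) :
    geomRep cs hA (cs.simple s) = cartanReflection A s :=
  cs.lift_apply_simple _ s

theorem geomRep_inv_apply_apply (hA : IsCartanMatrix M A) (w : G) (v : B →₀ ℝ) :
    geomRep cs hA w⁻¹ (geomRep cs hA w v) = v := by
  rw [← Module.End.mul_apply, ← map_mul, inv_mul_cancel, map_one, Module.End.one_apply]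

theorem geomRep_wordProd_alternatingWord (hA : IsCartanMatrix M A) {u : ℕ → ℝ} {s t : B} {k : ℝ}
    {c : ℝ} (hu : ∀ j, u (j + 2) = c * u (j + 1) - u j) (hu0 : u 0 = 0) (hu1 : u 1 = 1)
    (hk : 0 < k) (hst : A s t = -c * k) (hts : A t s = -c * k⁻¹) (n : ℕ) :
    geomRep cs hA (cs.wordProd (CoxeterSystem.alternatingWord s t n)) (Finsupp.single s 1) =
      if Even n then u (n + 1) • Finsupp.single s 1 + u n • k⁻¹ • Finsupp.single t 1
      else u n • Finsupp.single s 1 + u (n + 1) • k⁻¹ • Finsupp.single t 1 := by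
  have e1 : cartanReflection A s (Finsupp.single s 1) = -Finsupp.single s 1 :=
    hA.cartanReflection_single s
  have e2 : cartanReflection A t (Finsupp.single t 1) = -Finsupp.single t 1 :=
    hA.cartanReflection_single t
  have e3 : cartanReflection A s (Finsupp.single t 1) =
      Finsupp.single t 1 + (c * k) • Finsupp.single s 1 := by
    rw [cartanReflection_apply, linearCombination_single_one, hst]
    module
  have e4 : cartanReflection A t (Finsupp.single s 1) =
      Finsupp.single s 1 + (c * k⁻¹) • Finsupp.single t 1 := by
    rw [cartanReflection_apply, linearCombination_single_one, hts]
    module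
  induction n with
  | zero => simp [CoxeterSystem.alternatingWord, hu0, hu1]
  | succ n ih =>
    rw [CoxeterSystem.alternatingWord_succ', cs.wordProd_cons, map_mul, Module.End.mul_apply, ih,
      geomRep_simple, hu n]
    by_cases hn : Even n
    · have : ¬Even (n + 1) := by simpa [parity_simps] using hn
      simp only [hn, this, if_true, if_false, map_add, map_smul, e2, e4]
      module
    · have : Even (n + 1) := by simpa [parity_simps] using hn
      simp only [hn, this, if_true, if_false, map_add, map_smul, e1, e3]
      simp only [smul_add, smul_smul]
      rw [show u (n + 1) * (k⁻¹ * (c * k)) = c * u (n + 1) by field_simp]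
      module

/-- The entry 0 encodes infinite order, and π/0 = 0 makes the cosine 1. Then c = 2, the recurrence
is solved by u(j) = j, and the positive powers of the product of s and t move the basis vector of s,
so none of them is 1. -/
theorem coxeterMatrix_ne_zero {G : Type*} [Group G] [Finite G] (cs : CoxeterSystem M G)
    (hA : IsCartanMatrix M A) {s t : B} (hst : s ≠ t) :
    M s t ≠ 0 := by
  intro h0
  obtain ⟨k, hk, h1, h2⟩ := hA.exists_scale s t hst
  have hc : 2 * Real.cos (Real.pi / M s t) = 2 := by simp [h0]
  rw [hc] at h1 h2
  obtain ⟨n, hn, hpow⟩ : ∃ n, 0 < n ∧ (cs.simple s * cs.simple t) ^ n = 1 :=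
    ⟨_, orderOf_pos _, pow_orderOf_eq_one _⟩
  have key := geomRep_wordProd_alternatingWord cs hA (u := fun j => (j : ℝ)) (c := 2)
    (fun j => by push_cast; ring) (by simp) (by simp) hk h1 h2 (2 * n)
  rw [cs.prod_alternatingWord_eq_mul_pow, if_pos (even_two_mul n), if_pos (even_two_mul n),
    Nat.mul_div_cancel_left _ two_pos, hpow, one_mul, map_one, Module.End.one_apply] at key
  have := DFunLike.congr_fun key t
  simp [hst.symm] at this
  rcases this with h | h
  · omega
  · exact hk.ne' h

/-- Every element factors as a minimal coset representative times an alternating word. -/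
theorem exists_eq_mul_alternatingWord (i j : B) (w : G) :
    ∃ (v : G) (k : ℕ) (a b : B), (a = i ∧ b = j ∨ a = j ∧ b = i) ∧
      w = v * cs.wordProd (CoxeterSystem.alternatingWord a b k) ∧ cs.length w = cs.length v + k ∧
      ¬cs.IsRightDescent v i ∧ ¬cs.IsRightDescent v j := by
  induction h : cs.length w using Nat.strong_induction_on generalizing w with
  | _ n ih =>
  subst h
  by_cases hd : ∃ b, (b = i ∨ b = j) ∧ cs.IsRightDescent w b
  · obtain ⟨b, hb, hd⟩ := hd
    obtain ⟨v, k, a', b', hab, hw, hl, h1, h2⟩ := ih _ hd _ rfl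
    have hlen := cs.isRightDescent_iff.mp hd
    have hw' : w = v * cs.wordProd (CoxeterSystem.alternatingWord a' b' k) * cs.simple b := by
      rw [← hw, cs.simple_mul_simple_cancel_right]
    rcases k with _ | k
    · rcases hb with rfl | rfl
      · exact ⟨v, 1, j, b, Or.inr ⟨rfl, rfl⟩, by simpa [CoxeterSystem.alternatingWord] using hw',
          by omega, h1, h2⟩
      · exact ⟨v, 1, i, b, Or.inl ⟨rfl, rfl⟩, by simpa [CoxeterSystem.alternatingWord] using hw',
          by omega, h1, h2⟩
    · by_cases hbb : b = b'
      · subst hbb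
        exfalso
        rw [CoxeterSystem.alternatingWord_succ, cs.wordProd_concat, mul_assoc, mul_assoc,
          cs.simple_mul_simple_self, mul_one] at hw'
        have h3 := cs.length_mul_le v (cs.wordProd (CoxeterSystem.alternatingWord b a' k))
        have h4 := cs.length_wordProd_le (CoxeterSystem.alternatingWord b a' k)
        rw [← hw'] at h3
        rw [CoxeterSystem.length_alternatingWord] at h4
        omega
      · have : b = a' := by
          rcases hab with ⟨rfl, rfl⟩ | ⟨rfl, rfl⟩
          · exact hb.resolve_right hbb
          · exact hb.resolve_left hbb
        subst this
        refine ⟨v, k + 1 + 1, b', b, ?_, ?_, by omega, h1, h2⟩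
        · tauto
        · rw [CoxeterSystem.alternatingWord_succ _ _ (k + 1), cs.wordProd_concat, hw', mul_assoc]
  · push Not at hd
    exact ⟨w, 0, i, j, Or.inl ⟨rfl, rfl⟩, by simp [CoxeterSystem.alternatingWord], by simp,
      hd i (Or.inl rfl), hd j (Or.inr rfl)⟩

theorem isRightDescent_of_eq_mul_alternatingWord {v w : G} {k : ℕ} {a b : B} (hk : k ≠ 0)
    (hw : w = v * cs.wordProd (CoxeterSystem.alternatingWord a b k))
    (hl : cs.length w = cs.length v + k) : cs.IsRightDescent w b := by
  obtain ⟨k, rfl⟩ := Nat.exists_eq_succ_of_ne_zero hk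
  rw [Nat.succ_eq_add_one, CoxeterSystem.alternatingWord_succ, cs.wordProd_concat] at hw
  unfold CoxeterSystem.IsRightDescent
  have hw' : w * cs.simple b = v * cs.wordProd (CoxeterSystem.alternatingWord b a k) := by
    rw [hw, mul_assoc, mul_assoc, cs.simple_mul_simple_self, mul_one]
  rw [hw']
  have h3 := cs.length_mul_le v (cs.wordProd (CoxeterSystem.alternatingWord b a k))
  have h4 := cs.length_wordProd_le (CoxeterSystem.alternatingWord b a k)
  rw [CoxeterSystem.length_alternatingWord] at h4
  omega

theorem le_of_length_eq_mul_alternatingWord {v w : G} {k : ℕ} {a b : B} (hM : M a b ≠ 0)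
    (hw : w = v * cs.wordProd (CoxeterSystem.alternatingWord a b k))
    (hl : cs.length w = cs.length v + k) : k ≤ M a b := by
  by_contra hlt
  refine cs.not_isReduced_alternatingWord a b hM (not_le.mp hlt) ?_
  have h3 := cs.length_mul_le v (cs.wordProd (CoxeterSystem.alternatingWord a b k))
  have h4 := cs.length_wordProd_le (CoxeterSystem.alternatingWord a b k)
  rw [← hw] at h3
  rw [CoxeterSystem.length_alternatingWord] at h4
  rw [CoxeterSystem.IsReduced, CoxeterSystem.length_alternatingWord]
  omega

/-- Below length m the weights sin(jθ)/sin θ are nonnegative, so the alternating word sends the root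
of a to a nonnegative combination of the roots of a and b. -/
theorem geomRep_nonneg_of_lt (hA : IsCartanMatrix M A) {a b : B} (hab : a ≠ b) {v : G}
    (ha : 0 ≤ geomRep cs hA v (Finsupp.single a 1))
    (hb : 0 ≤ geomRep cs hA v (Finsupp.single b 1)) {k : ℕ} (hk : k < M a b) :
    0 ≤ geomRep cs hA (v * cs.wordProd (CoxeterSystem.alternatingWord a b k))
      (Finsupp.single a 1) := by
  have hm : 2 ≤ M a b := by
    have := M.off_diagonal a b hab
    omega
  obtain ⟨r, hr, h1, h2⟩ := hA.exists_scale a b hab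
  rw [map_mul, Module.End.mul_apply, geomRep_wordProd_alternatingWord cs hA
    (sinRatio_add_two (m := M a b)) sinRatio_zero (sinRatio_one hm) hr h1 h2]
  have p1 : 0 ≤ sinRatio (M a b) k := sinRatio_nonneg hm hk.le
  have p2 : 0 ≤ sinRatio (M a b) (k + 1) := sinRatio_nonneg hm hk
  split_ifs <;> simp only [map_add, map_smul] <;> positivity

/-- If `w s > w`, then `w` maps the simple root of `s` to a nonnegative combination of simple
roots. -/
theorem geomRep_nonneg (hA : IsCartanMatrix M A) (hM : ∀ s t, s ≠ t → M s t ≠ 0) {w : G} {s : B}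
    (h : ¬cs.IsRightDescent w s) : 0 ≤ geomRep cs hA w (Finsupp.single s 1) := by
  induction hn : cs.length w using Nat.strong_induction_on generalizing w s with
  | _ n ih =>
  subst hn
  by_cases hw1 : w = 1
  · rw [hw1, map_one, Module.End.one_apply]
    exact Finsupp.single_nonneg.mpr zero_le_one
  obtain ⟨t, ht⟩ := cs.exists_rightDescent_of_ne_one hw1
  have hst : s ≠ t := by
    rintro rfl
    exact h ht
  obtain ⟨v, k, a, b, hab, hw, hl, hvs, hvt⟩ := exists_eq_mul_alternatingWord cs s t w
  have hk : k ≠ 0 := by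
    rintro rfl
    have : w = v := by simpa [CoxeterSystem.alternatingWord] using hw
    exact hvt (this ▸ ht)
  have hb := isRightDescent_of_eq_mul_alternatingWord cs hk hw hl
  rcases hab with ⟨rfl, rfl⟩ | ⟨rfl, rfl⟩
  · have hle := le_of_length_eq_mul_alternatingWord cs (hM a b hst) hw hl
    have hlt : k < M a b := by
      -- At full length the braid relation rewrites the alternating word so that it ends in s, and s
      -- would be a descent of w.
      refine lt_of_le_of_ne hle fun hkm => h ?_
      rw [hkm, cs.wordProd_braidWord_eq] at hw
      rw [CoxeterSystem.braidWord, M.symmetric b a] at hw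
      exact isRightDescent_of_eq_mul_alternatingWord cs (hM a b hst) hw (hkm ▸ hl)
    rw [hw]
    exact geomRep_nonneg_of_lt cs hA hst (ih _ (by omega) hvs rfl)
      (ih _ (by omega) hvt rfl) hlt
  · exact absurd hb h

theorem geomRep_nonpos (hA : IsCartanMatrix M A) (hM : ∀ s t, s ≠ t → M s t ≠ 0) {w : G} {s : B}
    (h : cs.IsRightDescent w s) : geomRep cs hA w (Finsupp.single s 1) ≤ 0 := by
  have h1 := geomRep_nonneg cs hA hM (cs.isRightDescent_iff_not_isRightDescent_mul.mp h)
  rw [map_mul, Module.End.mul_apply, geomRep_simple, hA.cartanReflection_single, map_neg] at h1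
  exact neg_nonneg.mp h1

/-- Matsumoto's theorem: a map satisfying the braid relations takes the same value on all reduced
words of an element. -/
theorem prod_map_eq_of_isReduced (hA : IsCartanMatrix M A) (hM : ∀ s t, s ≠ t → M s t ≠ 0)
    {N : Type*} [Monoid N] (f : B → N)
    (hf : ∀ s t, s ≠ t → ((CoxeterSystem.alternatingWord s t (M s t)).map f).prod =
      ((CoxeterSystem.alternatingWord t s (M s t)).map f).prod)
    {ω ω' : List B} (hω : cs.IsReduced ω) (hω' : cs.IsReduced ω')
    (h : cs.wordProd ω = cs.wordProd ω') : (ω.map f).prod = (ω'.map f).prod := by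
  induction hn : ω.length using Nat.strong_induction_on generalizing ω ω' with
  | _ n ih =>
  subst hn
  have hlen : ω.length = ω'.length := by rw [← hω.eq, ← hω'.eq, h]
  rcases List.eq_nil_or_concat ω with rfl | ⟨μ, s, rfl⟩
  · rw [List.length_nil] at hlen
    rw [List.eq_nil_of_length_eq_zero hlen.symm]
  rcases List.eq_nil_or_concat ω' with rfl | ⟨μ', t, rfl⟩
  · simp at hlen
  have red : ∀ {μ : List B} {s : B}, cs.IsReduced (μ.concat s) → cs.IsReduced μ := by
    intro μ s hr
    have := hr.take μ.length
    rwa [List.concat_eq_append, List.take_left' rfl] at this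
  have hw : cs.wordProd (μ.concat s) = cs.wordProd μ * cs.simple s := cs.wordProd_concat s μ
  have hw' : cs.wordProd (μ.concat s) = cs.wordProd μ' * cs.simple t := by
    rw [h, cs.wordProd_concat]
  have hl : μ.length = μ'.length := by simpa using hlen
  have hμ : μ.length < (μ.concat s).length := by simp
  rcases eq_or_ne s t with rfl | hst
  · rw [List.concat_eq_append, List.concat_eq_append, List.map_append, List.map_append,
      List.prod_append, List.prod_append,
      ih _ hμ (red hω) (red hω') (mul_right_cancel (hw.symm.trans hw')) rfl]
  have descent : ∀ {ν : List B} {r : B}, ν.length = μ.length →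
      cs.wordProd (μ.concat s) = cs.wordProd ν * cs.simple r →
      cs.IsRightDescent (cs.wordProd (μ.concat s)) r := by
    intro ν r hν hr
    unfold CoxeterSystem.IsRightDescent
    rw [hω.eq, hr, cs.simple_mul_simple_cancel_right]
    have := cs.length_wordProd_le ν
    omega
  obtain ⟨v, k, a, b, hab, hv, hvl, hvs, hvt⟩ :=
    exists_eq_mul_alternatingWord cs s t (cs.wordProd (μ.concat s))
  have hne : a ≠ b := by rcases hab with ⟨rfl, rfl⟩ | ⟨rfl, rfl⟩ <;> tauto
  have ha : cs.IsRightDescent (cs.wordProd (μ.concat s)) a := by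
    rcases hab with ⟨rfl, rfl⟩ | ⟨rfl, rfl⟩
    exacts [descent rfl hw, descent hl.symm hw']
  have hva : ¬cs.IsRightDescent v a ∧ ¬cs.IsRightDescent v b := by
    rcases hab with ⟨rfl, rfl⟩ | ⟨rfl, rfl⟩ <;> tauto
  -- If k were smaller, the root of the descent a would have an image both nonnegative and
  -- nonpositive, hence zero, although w acts invertibly.
  have hk : k = M a b := by
    refine (le_of_length_eq_mul_alternatingWord cs (hM a b hne) hv hvl).eq_of_not_lt fun hlt => ?_
    have h1 := geomRep_nonneg_of_lt cs hA hne (geomRep_nonneg cs hA hM hva.1)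
      (geomRep_nonneg cs hA hM hva.2) hlt
    rw [← hv] at h1
    have h2 := le_antisymm (geomRep_nonpos cs hA hM ha) h1
    have h3 := geomRep_inv_apply_apply cs hA (cs.wordProd (μ.concat s)) (Finsupp.single a 1)
    rw [h2, map_zero] at h3
    exact (Finsupp.single_ne_zero.mpr one_ne_zero) h3.symm
  subst hk
  have hv' : cs.wordProd (μ.concat s) =
      v * cs.wordProd (CoxeterSystem.alternatingWord b a (M a b)) := by
    rw [hv, cs.wordProd_braidWord_eq, CoxeterSystem.braidWord, M.symmetric b a]
  obtain ⟨ν, hν, rfl⟩ := cs.exists_isReduced v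
  -- Both given words are compared with ν followed by a full alternating word ending in the same
  -- letter; after that letter is removed, the induction hypothesis applies.
  have step : ∀ {η : List B} {q r : B}, cs.IsReduced η → η.length = μ.length →
      cs.wordProd (μ.concat s) = cs.wordProd η * cs.simple r →
      cs.wordProd (μ.concat s) =
        cs.wordProd ν * cs.wordProd (CoxeterSystem.alternatingWord q r (M a b)) →
      ((η.concat r).map f).prod =
        (ν.map f).prod * ((CoxeterSystem.alternatingWord q r (M a b)).map f).prod := by
    intro η q r hη hηl h1 h2
    obtain ⟨m, hm⟩ := Nat.exists_eq_succ_of_ne_zero (hM a b hne)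
    rw [hm, Nat.succ_eq_add_one, CoxeterSystem.alternatingWord_succ] at h2 ⊢
    have h3 : cs.wordProd η = cs.wordProd (ν ++ CoxeterSystem.alternatingWord r q m) := by
      rw [cs.wordProd_append]
      rw [h1, cs.wordProd_concat, ← mul_assoc] at h2
      exact mul_right_cancel h2
    have h4 : cs.IsReduced (ν ++ CoxeterSystem.alternatingWord r q m) := by
      rw [CoxeterSystem.IsReduced, ← h3, hη.eq, List.length_append,
        CoxeterSystem.length_alternatingWord]
      rw [hω.eq, hν.eq, List.length_concat] at hvl
      omega
    have h5 := ih η.length (by omega) hη h4 h3 rfl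
    rw [List.map_append, List.prod_append] at h5
    rw [List.concat_eq_append, List.concat_eq_append, List.map_append, List.map_append,
      List.prod_append, List.prod_append, h5, mul_assoc]
  have hsymm := hf a b hne
  rcases hab with ⟨rfl, rfl⟩ | ⟨rfl, rfl⟩
  · rw [step (red hω) rfl hw hv', step (red hω') hl.symm hw' hv, hsymm]
  · rw [step (red hω) rfl hw hv, step (red hω') hl.symm hw' hv', hsymm]

end GeometricRepresentation

/-! ### The longest element. -/

section LongestElement

variable {B : Type*} {M : CoxeterMatrix B} {A : B → B → ℝ}

theorem Finsupp.map_nonneg_of_single {L : Module.End ℝ (B →₀ ℝ)}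
    (h : ∀ s, 0 ≤ L (Finsupp.single s 1)) {v : B →₀ ℝ} (hv : 0 ≤ v) : 0 ≤ L v := by
  have e : v = v.sum fun s x => x • Finsupp.single s 1 := by simp
  rw [e, map_finsuppSum]
  refine Finset.sum_nonneg fun s _ => ?_
  change 0 ≤ L (v s • Finsupp.single s 1)
  rw [map_smul]
  exact smul_nonneg (hv s) (h s)

variable {G : Type*} [Group G] (cs : CoxeterSystem M G)

theorem geomRep_single_ne_zero (hA : IsCartanMatrix M A) (w : G) (s : B) :
    geomRep cs hA w (Finsupp.single s 1) ≠ 0 := by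
  intro h
  have h3 := geomRep_inv_apply_apply cs hA w (Finsupp.single s 1)
  rw [h, map_zero] at h3
  exact (Finsupp.single_ne_zero.mpr one_ne_zero) h3.symm

theorem eq_one_of_forall_not_geomRep_nonpos (hA : IsCartanMatrix M A)
    (hM : ∀ s t, s ≠ t → M s t ≠ 0) {w : G}
    (h : ∀ s, ¬geomRep cs hA w (Finsupp.single s 1) ≤ 0) : w = 1 := by
  by_contra hw
  obtain ⟨s, hs⟩ := cs.exists_rightDescent_of_ne_one hw
  exact h s (geomRep_nonpos cs hA hM hs)

variable {w₀ : G}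

theorem isRightDescent_of_forall_length_le (hw₀ : ∀ w, cs.length w ≤ cs.length w₀) (s : B) :
    cs.IsRightDescent w₀ s :=
  lt_of_le_of_ne (hw₀ _) (cs.length_mul_simple_ne w₀ s)

theorem isLeftDescent_of_forall_length_le (hw₀ : ∀ w, cs.length w ≤ cs.length w₀) (s : B) :
    cs.IsLeftDescent w₀ s :=
  lt_of_le_of_ne (hw₀ _) (cs.length_simple_mul_ne w₀ s)

theorem geomRep_longest_nonpos (hA : IsCartanMatrix M A) (hM : ∀ s t, s ≠ t → M s t ≠ 0)
    (hw₀ : ∀ w, cs.length w ≤ cs.length w₀) {v : B →₀ ℝ} (hv : 0 ≤ v) :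
    geomRep cs hA w₀ v ≤ 0 := by
  have := Finsupp.map_nonneg_of_single (L := -geomRep cs hA w₀) (fun s => by
    rw [LinearMap.neg_apply, neg_nonneg]
    exact geomRep_nonpos cs hA hM (isRightDescent_of_forall_length_le cs hw₀ s)) hv
  rwa [LinearMap.neg_apply, neg_nonneg] at this

theorem geomRep_longest_nonneg (hA : IsCartanMatrix M A) (hM : ∀ s t, s ≠ t → M s t ≠ 0)
    (hw₀ : ∀ w, cs.length w ≤ cs.length w₀) {v : B →₀ ℝ} (hv : v ≤ 0) :
    0 ≤ geomRep cs hA w₀ v := by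
  have := geomRep_longest_nonpos cs hA hM hw₀ (neg_nonneg.mpr hv)
  rwa [map_neg, neg_nonpos] at this

theorem longest_mul_self (hA : IsCartanMatrix M A) (hM : ∀ s t, s ≠ t → M s t ≠ 0)
    (hw₀ : ∀ w, cs.length w ≤ cs.length w₀) : w₀ * w₀ = 1 := by
  refine eq_one_of_forall_not_geomRep_nonpos cs hA hM fun s h => ?_
  have h1 : 0 ≤ geomRep cs hA (w₀ * w₀) (Finsupp.single s 1) := by
    rw [map_mul, Module.End.mul_apply]
    exact geomRep_longest_nonneg cs hA hM hw₀
      (geomRep_longest_nonpos cs hA hM hw₀ (Finsupp.single_nonneg.mpr zero_le_one))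
  exact geomRep_single_ne_zero cs hA _ s (le_antisymm h h1)

/-- The longest element acts on the simple roots by minus a permutation, up to scaling. -/
theorem exists_longest_conj (hA : IsCartanMatrix M A) (hM : ∀ s t, s ≠ t → M s t ≠ 0)
    (hw₀ : ∀ w, cs.length w ≤ cs.length w₀) (s : B) :
    ∃ (t : B) (k : ℝ), 0 < k ∧ cs.simple t = w₀ * cs.simple s * w₀ ∧
      geomRep cs hA w₀ (Finsupp.single s 1) = -k • Finsupp.single t 1 := by
  have hsq := longest_mul_self cs hA hM hw₀
  have hinv : ∀ v, geomRep cs hA w₀ (geomRep cs hA w₀ v) = v := fun v => by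
    rw [← Module.End.mul_apply, ← map_mul, hsq, map_one, Module.End.one_apply]
  have hx : w₀ * cs.simple s * w₀ ≠ 1 := by
    intro h
    have h1 : cs.simple s = 1 := by
      calc cs.simple s = w₀ * (w₀ * cs.simple s * w₀) * w₀ := by
            rw [← mul_assoc, ← mul_assoc, hsq, one_mul, mul_assoc, hsq, mul_one]
        _ = 1 := by rw [h, mul_one, hsq]
    have h2 := cs.length_simple s
    rw [h1, cs.length_one] at h2
    exact zero_ne_one h2
  have hxv : ∀ v, geomRep cs hA (w₀ * cs.simple s * w₀) v =
      geomRep cs hA w₀ (cartanReflection A s (geomRep cs hA w₀ v)) := fun v => by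
    simp only [map_mul, Module.End.mul_apply, geomRep_simple]
  obtain ⟨t, ht⟩ := cs.exists_rightDescent_of_ne_one hx
  have h1 := geomRep_nonpos cs hA hM ht
  rw [hxv] at h1
  have h2 := geomRep_longest_nonneg cs hA hM hw₀ h1
  rw [hinv] at h2
  have h3 := geomRep_longest_nonpos cs hA hM hw₀ (v := Finsupp.single t 1)
    (Finsupp.single_nonneg.mpr zero_le_one)
  set p := geomRep cs hA w₀ (Finsupp.single t 1) with hp
  -- Here p ≤ 0, while its reflection in s is ≥ 0. The reflection changes only the coordinate at s,
  -- so all other coordinates of p vanish.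
  have hps : p = p s • Finsupp.single s 1 := by
    ext r
    rcases eq_or_ne s r with rfl | hsr
    · simp
    · have h4 := h2 r
      have h5 := h3 r
      simp [cartanReflection_apply, hsr] at h4 h5 ⊢
      exact le_antisymm h5 h4
  have hp0 : p s < 0 := by
    refine lt_of_le_of_ne (h3 s) fun h => geomRep_single_ne_zero cs hA w₀ t ?_
    rw [← hp, hps, h]
    simp
  have hs : geomRep cs hA w₀ (Finsupp.single s 1) = -(-p s)⁻¹ • Finsupp.single t 1 := by
    have h4 := hinv (Finsupp.single t 1)
    rw [← hp, hps, map_smul] at h4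
    rw [← h4, smul_smul, inv_neg, neg_neg, inv_mul_cancel₀ hp0.ne, one_smul]
  refine ⟨t, (-p s)⁻¹, inv_pos.mpr (neg_pos.mpr hp0), ?_, hs⟩
  suffices h : w₀ * cs.simple s * w₀ * cs.simple t = 1 by
    rw [mul_eq_one_iff_eq_inv, cs.inv_simple] at h
    exact h.symm
  -- The product has no descent: it fixes the root of t, and for r ≠ t it keeps the coordinate 1 at
  -- r of the root of r.
  refine eq_one_of_forall_not_geomRep_nonpos cs hA hM fun r hr => ?_
  rw [map_mul, Module.End.mul_apply, geomRep_simple] at hr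
  rcases eq_or_ne r t with rfl | hrt
  · rw [hA.cartanReflection_single, map_neg, hxv, ← hp, hps, map_smul, hA.cartanReflection_single,
      smul_neg, map_neg, map_smul, hs, neg_neg, smul_smul] at hr
    have := hr r
    rw [inv_neg, neg_neg, mul_inv_cancel₀ hp0.ne] at this
    simp at this
    linarith
  · have := hr r
    rw [hxv, cartanReflection_apply s, map_sub, hinv, map_smul, hs, cartanReflection_apply] at this
    simp [hrt] at this
    linarith

end LongestElement

/-! ### The cone of simple roots. -/

section RootCone

variable {V : Type*} [AddCommGroup V] [Module ℝ V] {B : Type*} {α : B → V}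

/-- The cone spanned by the simple roots. -/
def rootCone (α : B → V) : Set V :=
  {v | ∃ c : B →₀ ℝ, 0 ≤ c ∧ Finsupp.linearCombination ℝ α c = v}

theorem zero_mem_rootCone : (0 : V) ∈ rootCone α :=
  ⟨0, le_rfl, map_zero _⟩

theorem add_mem_rootCone {v v' : V} (h : v ∈ rootCone α) (h' : v' ∈ rootCone α) :
    v + v' ∈ rootCone α := by
  obtain ⟨c, hc, rfl⟩ := h
  obtain ⟨c', hc', rfl⟩ := h'
  exact ⟨c + c', add_nonneg hc hc', map_add _ _ _⟩

theorem smul_mem_rootCone {v : V} (h : v ∈ rootCone α) {x : ℝ} (hx : 0 ≤ x) :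
    x • v ∈ rootCone α := by
  obtain ⟨c, hc, rfl⟩ := h
  exact ⟨x • c, smul_nonneg hx hc, map_smul _ _ _⟩

end RootCone

/-! ### Transfer from the geometric representation to V. -/

namespace IsSimpleRootSystem

variable {V : Type*} [AddCommGroup V] [Module ℝ V] [TopologicalSpace V]
  {B : Type*} {M : CoxeterMatrix B} {W : Subgroup (V ≃L[ℝ] V)} {cs : CoxeterSystem M W}
  {α : B → V} {αv : B → V →L[ℝ] ℝ}

theorem coe_mul_apply (w w' : W) (v : V) :
    ((w * w' : W) : V ≃L[ℝ] V) v = (w : V ≃L[ℝ] V) ((w' : V ≃L[ℝ] V) v) :=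
  rfl

theorem coe_one_apply (v : V) : ((1 : W) : V ≃L[ℝ] V) v = v :=
  rfl

theorem root_ne_zero (hα : IsSimpleRootSystem cs α αv) (s : B) : α s ≠ 0 := by
  intro h
  have := hα.pairing_self s
  rw [h, map_zero] at this
  norm_num at this

/-- When m(s, t) = 2 the hypotheses only make the product of the two pairings zero; that both vanish
comes from the commutation of s and t. -/
theorem pairing_eq_zero (hα : IsSimpleRootSystem cs α αv) {s t : B} (h : M s t = 2)
    (hst : αv s (α t) = 0) : αv t (α s) = 0 := by
  have h1 := cs.simple_mul_simple_pow s t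
  rw [h, pow_two, mul_eq_one_iff_eq_inv, mul_inv_rev, cs.inv_simple, cs.inv_simple] at h1
  have h2 := congrArg (fun w : W => (w : V ≃L[ℝ] V) (α s)) h1
  simp only [coe_mul_apply, hα.reflection, map_sub, map_smul,
    hα.pairing_self, hst] at h2
  have h3 : (2 * αv t (α s)) • α t = 0 := by
    rw [← sub_eq_zero] at h2
    rw [← neg_eq_zero, ← h2]
    simp only [smul_eq_mul]
    module
  have := (smul_eq_zero.mp h3).resolve_right (hα.root_ne_zero t)
  linarith

theorem isCartanMatrix (hα : IsSimpleRootSystem cs α αv) :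
    IsCartanMatrix M fun s t => αv s (α t) where
  diag := hα.pairing_self
  exists_scale s t hst := by
    have hmul := hα.pairing_mul s t hst
    have hoff := M.off_diagonal s t hst
    by_cases h2 : M s t = 2
    · have hc : Real.cos (Real.pi / M s t) = 0 := by
        rw [h2, Nat.cast_ofNat, Real.cos_pi_div_two]
      rw [hc] at hmul ⊢
      rw [zero_pow two_ne_zero, mul_zero] at hmul
      have h : αv s (α t) = 0 ∧ αv t (α s) = 0 := by
        rcases mul_eq_zero.mp hmul with h | h
        · exact ⟨h, hα.pairing_eq_zero h2 h⟩
        · exact ⟨hα.pairing_eq_zero (by rw [M.symmetric, h2]) h, h⟩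
      exact ⟨1, one_pos, by simp [h.1], by simp [h.2]⟩
    · have hc : 0 < Real.cos (Real.pi / M s t) := by
        by_cases h0 : M s t = 0
        -- Infinite order is encoded by 0; since π/0 = 0, the cosine is 1.
        · simp [h0]
        · have h3 : (3 : ℝ) ≤ M s t := by
            have : 3 ≤ M s t := by omega
            exact_mod_cast this
          refine Real.cos_pos_of_mem_Ioo ⟨?_, ?_⟩
          · have : 0 < Real.pi / M s t := by positivity
            linarith [Real.pi_pos]
          · exact div_lt_div_of_pos_left Real.pi_pos two_pos (by linarith)
      have hneg : αv s (α t) < 0 := by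
        refine lt_of_le_of_ne (hα.pairing_nonpos s t hst) fun h => ?_
        rw [h, zero_mul] at hmul
        have : 0 < 4 * Real.cos (Real.pi / M s t) ^ 2 := by positivity
        linarith
      refine ⟨-αv s (α t) / (2 * Real.cos (Real.pi / M s t)), ?_, ?_, ?_⟩
      · exact div_pos (neg_pos.mpr hneg) (by positivity)
      · field_simp
      · have := hneg.ne
        field_simp
        linarith

theorem coxeterMatrix_ne_zero [Finite W] (hα : IsSimpleRootSystem cs α αv) (s t : B)
    (hst : s ≠ t) : M s t ≠ 0 :=
  _root_.coxeterMatrix_ne_zero cs hα.isCartanMatrix hst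

theorem linearCombination_pairing (s : B) (v : B →₀ ℝ) :
    Finsupp.linearCombination ℝ (fun t => αv s (α t)) v =
      αv s (Finsupp.linearCombination ℝ α v) := by
  simp [Finsupp.linearCombination_apply, map_finsuppSum]

theorem linearCombination_cartanReflection (hα : IsSimpleRootSystem cs α αv) (s : B)
    (v : B →₀ ℝ) :
    Finsupp.linearCombination ℝ α (cartanReflection (fun s t => αv s (α t)) s v) =
      (cs.simple s : V ≃L[ℝ] V) (Finsupp.linearCombination ℝ α v) := by
  rw [cartanReflection_apply, map_sub, map_smul, hα.reflection, linearCombination_pairing]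
  simp

theorem linearCombination_geomRep (hα : IsSimpleRootSystem cs α αv) (w : W) (v : B →₀ ℝ) :
    Finsupp.linearCombination ℝ α (geomRep cs hα.isCartanMatrix w v) =
      (w : V ≃L[ℝ] V) (Finsupp.linearCombination ℝ α v) := by
  induction w using cs.simple_induction_left with
  | one => rw [map_one, Module.End.one_apply, coe_one_apply]
  | mul_simple_left w s ih =>
    rw [map_mul, Module.End.mul_apply, geomRep_simple, hα.linearCombination_cartanReflection, ih,
      coe_mul_apply]

/-- A relation among the simple roots pairs to zero with every coroot, so W fixes it in the
geometric representation; a nonnegative one is made nonpositive by `w₀`. This replaces linear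
independence and makes the root cone pointed. -/
theorem eq_zero_of_linearCombination_eq_zero [Finite W] (hα : IsSimpleRootSystem cs α αv) {w₀ : W}
    (hw₀ : ∀ w, cs.length w ≤ cs.length w₀) {c : B →₀ ℝ} (hc : 0 ≤ c)
    (h : Finsupp.linearCombination ℝ α c = 0) : c = 0 := by
  have h1 : ∀ w, geomRep cs hα.isCartanMatrix w c = c := by
    intro w
    induction w using cs.simple_induction_left with
    | one => simp
    | mul_simple_left w s ih =>
      rw [map_mul, Module.End.mul_apply, geomRep_simple, ih, cartanReflection_apply,
        linearCombination_pairing, h, map_zero, zero_smul, sub_zero]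
  have h2 := geomRep_longest_nonpos cs hα.isCartanMatrix hα.coxeterMatrix_ne_zero hw₀ hc
  rw [h1] at h2
  exact le_antisymm h2 hc

theorem exists_longest_conj [Finite W] (hα : IsSimpleRootSystem cs α αv) {w₀ : W}
    (hw₀ : ∀ w, cs.length w ≤ cs.length w₀) (s : B) :
    ∃ (t : B) (k : ℝ), 0 < k ∧ cs.simple t = w₀ * cs.simple s * w₀ ∧
      (w₀ : V ≃L[ℝ] V) (α s) = -k • α t ∧
      ∀ v, αv t (-(w₀ : V ≃L[ℝ] V) v) = k * αv s v := by
  obtain ⟨t, k, hk, ht, hs⟩ :=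
    _root_.exists_longest_conj cs hα.isCartanMatrix hα.coxeterMatrix_ne_zero hw₀ s
  have hs' : (w₀ : V ≃L[ℝ] V) (α s) = -k • α t := by
    have := hα.linearCombination_geomRep w₀ (Finsupp.single s 1)
    rw [hs] at this
    simpa using this.symm
  refine ⟨t, k, hk, ht, hs', fun v => ?_⟩
  have hsq := longest_mul_self cs hα.isCartanMatrix hα.coxeterMatrix_ne_zero hw₀
  have h1 : cs.simple t * w₀ = w₀ * cs.simple s := by
    rw [ht, mul_assoc, hsq, mul_one]
  have h2 := congrArg (fun w : W => (w : V ≃L[ℝ] V) v) h1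
  simp only [coe_mul_apply, hα.reflection, map_sub, map_smul,
    hs', sub_right_inj, smul_smul] at h2
  have h3 := smul_left_injective ℝ (hα.root_ne_zero t) h2
  rw [map_neg, h3]
  ring

theorem eq_of_sub_mem_rootCone [Finite W] (hα : IsSimpleRootSystem cs α αv) {w₀ : W}
    (hw₀ : ∀ w, cs.length w ≤ cs.length w₀) {v v' : V} (h : v - v' ∈ rootCone α)
    (h' : v' - v ∈ rootCone α) : v = v' := by
  obtain ⟨c, hc, h⟩ := h
  obtain ⟨c', hc', h'⟩ := h'
  have h1 := hα.eq_zero_of_linearCombination_eq_zero hw₀ (add_nonneg hc hc')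
    (by rw [map_add, h, h']; abel)
  have h2 : c = 0 := le_antisymm (by rw [← h1]; exact le_add_of_nonneg_right hc') hc
  rw [h2, map_zero] at h
  exact (sub_eq_zero.mp h.symm)

/-- Removing a descent s of w changes the difference by a nonnegative multiple of the image of `α s`
under ws, which lies in the cone because ws is shorter than w. -/
theorem sub_apply_mem_rootCone [Finite W] (hα : IsSimpleRootSystem cs α αv) {v : V}
    (hv : ∀ s, 0 ≤ αv s v) (w : W) : v - (w : V ≃L[ℝ] V) v ∈ rootCone α := by
  induction hn : cs.length w using Nat.strong_induction_on generalizing w with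
  | _ n ih =>
  subst hn
  by_cases hw : w = 1
  · rw [hw, coe_one_apply, sub_self]
    exact zero_mem_rootCone
  obtain ⟨s, hs⟩ := cs.exists_rightDescent_of_ne_one hw
  have h1 := geomRep_nonneg cs hα.isCartanMatrix hα.coxeterMatrix_ne_zero
    (cs.isRightDescent_iff_not_isRightDescent_mul.mp hs)
  have h2 := hα.linearCombination_geomRep (w * cs.simple s) (Finsupp.single s 1)
  have h3 := ih _ hs (w * cs.simple s) rfl
  have h4 : v - (w : V ≃L[ℝ] V) v = (v - ((w * cs.simple s : W) : V ≃L[ℝ] V) v) +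
      αv s v • ((w * cs.simple s : W) : V ≃L[ℝ] V) (α s) := by
    simp only [coe_mul_apply, hα.reflection, hα.pairing_self,
      map_sub, map_smul]
    module
  rw [h4]
  refine add_mem_rootCone h3 (smul_mem_rootCone ⟨_, h1, ?_⟩ (hv s))
  rw [h2]
  simp

end IsSimpleRootSystem

/-! ### Pitman transforms, time reversal and the involution. -/

namespace PitmanPath

section Involution

variable {T : ℝ} {V : Type*} [AddCommGroup V] [Module ℝ V] [TopologicalSpace V]
  [IsTopologicalAddGroup V] [ContinuousSMul ℝ V]

theorem runInf_coroot_nonpos (β : V →L[ℝ] ℝ) (π : PitmanPath T V) (t : Set.Icc (0 : ℝ) T) :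
    runInf (fun s => β (π s)) t ≤ 0 := by
  have h0 : (⟨0, le_rfl, t.2.1.trans t.2.2⟩ : Set.Icc (0 : ℝ) T) ≤ t := t.2.1
  have := runInf_le (continuous_coroot β π) h0
  rwa [π.map_zero _ rfl, _root_.map_zero] at this

theorem coroot_pitman_nonneg {a : V} {β : V →L[ℝ] ℝ} (h : β a = 2) (π : PitmanPath T V)
    (t : Set.Icc (0 : ℝ) T) : 0 ≤ β (pitman a β π t) := by
  have h1 := congrFun (coroot_pitman_self h π) t
  have h2 := runInf_coroot_nonpos β π t
  have h3 := runInf_le (continuous_coroot β π) (le_refl t)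
  linarith

theorem pitman_eq_self {a : V} {β : V →L[ℝ] ℝ} {π : PitmanPath T V} (h : ∀ t, 0 ≤ β (π t)) :
    pitman a β π = π := by
  ext t
  have : runInf (fun s => β (π s)) t = 0 :=
    le_antisymm (runInf_coroot_nonpos β π t) (le_runInf (continuous_coroot β π) fun s _ => h s)
  rw [pitman_apply, this, zero_smul, sub_zero]

theorem pitman_pitman {a : V} {β : V →L[ℝ] ℝ} (h : β a = 2) (π : PitmanPath T V) :
    pitman a β (pitman a β π) = pitman a β π :=
  pitman_eq_self (coroot_pitman_nonneg h π)

theorem map_apply (f : V →L[ℝ] V) (π : PitmanPath T V) (t : Set.Icc (0 : ℝ) T) :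
    map f π t = f (π t) :=
  rfl

/-- Intertwining of Pitman transforms by a linear map that matches two roots up to scaling. -/
theorem map_pitman (f : V →L[ℝ] V) {a b : V} {β γ : V →L[ℝ] ℝ} {k : ℝ} (hk : 0 ≤ k)
    (ha : f a = k • b) (hγ : ∀ v, γ (f v) = k * β v) (π : PitmanPath T V) :
    map f (pitman a β π) = pitman b γ (map f π) := by
  ext t
  have : runInf (fun s => γ (map f π s)) t = k * runInf (fun s => β (π s)) t := by
    simp only [map_apply, hγ]
    exact runInf_const_mul (continuous_coroot β π) hk t
  rw [map_apply, pitman_apply, pitman_apply, this, map_sub, map_smul, ha, smul_smul, mul_comm k,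
    map_apply]

variable {B : Type*} {α : B → V} {αv : B → V →L[ℝ] ℝ}

theorem pitmanWord_eq_self {π : PitmanPath T V} (h : IsDominant αv π) (ω : List B) :
    pitmanWord α αv ω π = π := by
  induction ω with
  | nil => rfl
  | cons s ω ih => rw [pitmanWord_cons, ih, pitman_eq_self (h s)]

theorem pitmanWord_eq_prod (ω : List B) (π : PitmanPath T V) :
    pitmanWord α αv ω π =
      (ω.map (β := Function.End (PitmanPath T V)) fun s => pitman (α s) (αv s)).prod π := by
  induction ω with
  | nil => rfl
  | cons s ω ih =>
    rw [pitmanWord_cons, ih]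
    rfl

section Reversal

theorem revTime_revTime (t : Set.Icc (0 : ℝ) T) : revTime (revTime t) = t :=
  Subtype.ext (sub_sub_cancel T t)

theorem revTime_le_revTime {s t : Set.Icc (0 : ℝ) T} (h : s ≤ t) : revTime t ≤ revTime s :=
  sub_le_sub_left (show (s : ℝ) ≤ t from h) T

variable [hT : Fact (0 < T)]

theorem le_endTime (t : Set.Icc (0 : ℝ) T) : t ≤ endTime T :=
  t.2.2

theorem revTime_endTime : ((revTime (endTime T) : Set.Icc (0 : ℝ) T) : ℝ) = 0 :=
  sub_self T

theorem kappa_apply (π : PitmanPath T V) (t : Set.Icc (0 : ℝ) T) :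
    kappa π t = π (revTime t) - π (endTime T) :=
  rfl

theorem kappa_endTime (π : PitmanPath T V) : kappa π (endTime T) = -π (endTime T) := by
  rw [kappa_apply, π.map_zero _ revTime_endTime, zero_sub]

theorem kappa_kappa (π : PitmanPath T V) : kappa (kappa π) = π := by
  ext t
  rw [kappa_apply, kappa_endTime, kappa_apply, revTime_revTime]
  abel

theorem map_kappa (f : V →L[ℝ] V) (π : PitmanPath T V) : map f (kappa π) = kappa (map f π) := by
  ext t
  rw [map_apply, kappa_apply, map_sub]
  rfl

/-- Time reversal of a Pitman transform has the same Pitman transform as the reversed path. -/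
theorem pitman_kappa_pitman {a : V} {β : V →L[ℝ] ℝ} (h : β a = 2) (π : PitmanPath T V) :
    pitman a β (kappa (pitman a β π)) = pitman a β (kappa π) := by
  ext t
  have hz := continuous_coroot β π
  have hκ := continuous_coroot β (kappa π)
  have e1 : ∀ s, β (kappa π s) = β (π (revTime s)) - β (π (endTime T)) := fun s => by
    rw [kappa_apply, map_sub]
  have e2 : ∀ s, β (kappa (pitman a β π) s) =
      (β (π (revTime s)) - 2 * runInf (fun s => β (π s)) (revTime s)) -
        (β (π (endTime T)) - 2 * runInf (fun s => β (π s)) (endTime T)) := fun s => by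
    have h1 := congrFun (coroot_pitman_self h π)
    rw [kappa_apply, map_sub]
    exact congrArg₂ _ (h1 _) (h1 _)
  -- The infimum identity on the window from time T - s to T, read in reversed time.
  have key : runInf (fun s => β (kappa (pitman a β π) s)) t =
      runInf (fun s => β (kappa π s)) t - runInf (fun s => β (π s)) (revTime t)
        + runInf (fun s => β (π s)) (endTime T) := by
    refine runInf_eq_of_forall (continuous_coroot β _) (fun s hs => ?_) ?_
    · obtain ⟨q, h1, -, h2⟩ :=
        exists_le_sub_two_runInf hz (revTime_le_revTime hs) (le_endTime (revTime s))
      have h3 : revTime q ≤ t := by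
        have := revTime_le_revTime h1
        rwa [revTime_revTime] at this
      have h4 := runInf_le hκ h3
      rw [e1, revTime_revTime] at h4
      rw [e2]
      linarith
    · obtain ⟨s, hs, es⟩ := exists_eq_runInf hκ t
      obtain ⟨q, h1, -, h2⟩ :=
        exists_sub_two_runInf_le hz (revTime_le_revTime hs) (le_endTime (revTime s))
      refine ⟨revTime q, ?_, ?_⟩
      · have := revTime_le_revTime h1
        rwa [revTime_revTime] at this
      · rw [e2, revTime_revTime, ← es, e1]
        linarith
  rw [pitman_apply, pitman_apply, key, kappa_apply, kappa_apply, pitman_apply, pitman_apply]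
  module

end Reversal

section Longest

variable {M : CoxeterMatrix B} {W : Subgroup (V ≃L[ℝ] V)} {cs : CoxeterSystem M W}

theorem pitmanWord_braidWord (hα : IsSimpleRootSystem cs α αv) {s t : B} (hst : s ≠ t)
    (hM : M s t ≠ 0) (π : PitmanPath T V) :
    pitmanWord α αv (CoxeterSystem.alternatingWord s t (M s t)) π =
      pitmanWord α αv (CoxeterSystem.alternatingWord t s (M s t)) π := by
  classical
  have hm : 2 ≤ M s t := by
    have := M.off_diagonal s t hst
    omega
  obtain ⟨k, hk, h1, h2⟩ := hα.isCartanMatrix.exists_scale s t hst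
  -- Rescaling the root of t by k⁻¹, and its coroot inversely, makes the two off-diagonal pairings
  -- equal without changing the Pitman transforms.
  set c : B → ℝ := fun r => if r = t then k⁻¹ else 1 with hc
  have hcpos : ∀ r, 0 < c r := fun r => by
    rw [hc]
    dsimp only
    split_ifs <;> positivity
  have hcs : c s = 1 := if_neg hst
  have hct : c t = k⁻¹ := if_pos rfl
  have hself : ∀ r, ((c r)⁻¹ • αv r) (c r • α r) = 2 := fun r => by
    rw [map_smul, smul_apply, hα.pairing_self, smul_eq_mul, smul_eq_mul,
      mul_inv_cancel_left₀ (hcpos r).ne']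
  rw [← pitmanWord_smul_inv_smul α αv hcpos, ← pitmanWord_smul_inv_smul α αv hcpos]
  refine pitmanWord_alternatingWord_comm (c := 2 * Real.cos (Real.pi / M s t))
    (sinRatio_add_two (m := M s t)) sinRatio_zero (sinRatio_one hm) (by omega)
    (fun l hl => sinRatio_nonneg hm hl) (sinRatio_self hm) (hself s) (hself t) ?_ ?_ π
  · change αv s (α t) = _ at h1
    rw [map_smul, smul_apply, h1, hcs, hct, smul_eq_mul, smul_eq_mul]
    field_simp
  · change αv t (α s) = _ at h2
    rw [map_smul, smul_apply, h2, hcs, hct, smul_eq_mul, smul_eq_mul]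
    field_simp

theorem pitmanWord_eq_of_isReduced [Finite W] (hα : IsSimpleRootSystem cs α αv) {ω ω' : List B}
    (hω : cs.IsReduced ω) (hω' : cs.IsReduced ω') (h : cs.wordProd ω = cs.wordProd ω')
    (π : PitmanPath T V) : pitmanWord α αv ω π = pitmanWord α αv ω' π := by
  rw [pitmanWord_eq_prod, pitmanWord_eq_prod]
  refine congrFun (prod_map_eq_of_isReduced cs hα.isCartanMatrix hα.coxeterMatrix_ne_zero
    (N := Function.End (PitmanPath T V)) (fun s => pitman (α s) (αv s)) (fun s t hst => ?_)
    hω hω' h) π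
  funext η
  have := pitmanWord_braidWord hα hst (hα.coxeterMatrix_ne_zero s t hst) η
  rwa [pitmanWord_eq_prod, pitmanWord_eq_prod] at this

theorem pitmanWord_eq_pitmanOp [Finite W] (hα : IsSimpleRootSystem cs α αv) {ω : List B} {w : W}
    (hω : cs.IsReduced ω) (h : cs.wordProd ω = w) (π : PitmanPath T V) :
    pitmanWord α αv ω π = pitmanOp cs α αv w π :=
  have hw := Classical.choose_spec (cs.exists_isReduced w)
  pitmanWord_eq_of_isReduced hα hω hw.1 (h.trans hw.2) π

variable [Finite W] {w₀ : W}

/-- `w₀` has a reduced word ending in s, and P_s is idempotent. -/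
theorem pitmanOp_pitman (hα : IsSimpleRootSystem cs α αv)
    (hw₀ : ∀ w, cs.length w ≤ cs.length w₀) (s : B) (π : PitmanPath T V) :
    pitmanOp cs α αv w₀ (pitman (α s) (αv s) π) = pitmanOp cs α αv w₀ π := by
  obtain ⟨ω, hω, h⟩ := cs.exists_isReduced (w₀ * cs.simple s)
  have h1 : cs.wordProd (ω.concat s) = w₀ := by
    rw [cs.wordProd_concat, ← h, cs.simple_mul_simple_cancel_right]
  have h2 : cs.IsReduced (ω.concat s) := by
    have := cs.isRightDescent_iff.mp (isRightDescent_of_forall_length_le cs hw₀ s)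
    rw [CoxeterSystem.IsReduced, h1, List.length_concat, ← hω.eq, ← h, this]
  rw [← pitmanWord_eq_pitmanOp hα h2 h1, ← pitmanWord_eq_pitmanOp hα h2 h1, pitmanWord_concat,
    pitmanWord_concat, pitman_pitman (hα.pairing_self s)]

theorem isDominant_pitmanOp (hα : IsSimpleRootSystem cs α αv)
    (hw₀ : ∀ w, cs.length w ≤ cs.length w₀) (π : PitmanPath T V) :
    IsDominant αv (pitmanOp cs α αv w₀ π) := by
  intro s t
  obtain ⟨ω, hω, h⟩ := cs.exists_isReduced (cs.simple s * w₀)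
  have h1 : cs.wordProd (s :: ω) = w₀ := by
    rw [cs.wordProd_cons, ← h, cs.simple_mul_simple_cancel_left]
  have h2 : cs.IsReduced (s :: ω) := by
    have := cs.isLeftDescent_iff.mp (isLeftDescent_of_forall_length_le cs hw₀ s)
    rw [CoxeterSystem.IsReduced, h1, List.length_cons, ← hω.eq, ← h, this]
  rw [← pitmanWord_eq_pitmanOp hα h2 h1, pitmanWord_cons]
  exact coroot_pitman_nonneg (hα.pairing_self s) _ t

theorem pitmanOp_eq_self {π : PitmanPath T V} (h : IsDominant αv π) (w : W) :
    pitmanOp cs α αv w π = π :=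
  pitmanWord_eq_self h _

theorem neg_longest_comp_self (hα : IsSimpleRootSystem cs α αv)
    (hw₀ : ∀ w, cs.length w ≤ cs.length w₀) (π : PitmanPath T V) :
    map (-((w₀ : V ≃L[ℝ] V) : V →L[ℝ] V)) (map (-((w₀ : V ≃L[ℝ] V) : V →L[ℝ] V)) π) = π := by
  ext t
  have hsq := longest_mul_self cs hα.isCartanMatrix hα.coxeterMatrix_ne_zero hw₀
  have := IsSimpleRootSystem.coe_mul_apply w₀ w₀ (π t)
  rw [hsq, IsSimpleRootSystem.coe_one_apply] at this
  simp [map_apply, ← this]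

/-- Conjugation by `w₀` sends a reduced word of `w₀` to another one, letter by letter, and -w₀
intertwines the corresponding Pitman transforms. -/
theorem pitmanOp_map_neg_longest (hα : IsSimpleRootSystem cs α αv)
    (hw₀ : ∀ w, cs.length w ≤ cs.length w₀) (π : PitmanPath T V) :
    pitmanOp cs α αv w₀ (map (-((w₀ : V ≃L[ℝ] V) : V →L[ℝ] V)) π) =
      map (-((w₀ : V ≃L[ℝ] V) : V →L[ℝ] V)) (pitmanOp cs α αv w₀ π) := by
  have hsq := longest_mul_self cs hα.isCartanMatrix hα.coxeterMatrix_ne_zero hw₀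
  choose d k hk hd hroot hcoroot using fun s => hα.exists_longest_conj hw₀ s
  have hword : ∀ ω : List B, cs.wordProd (ω.map d) = w₀ * cs.wordProd ω * w₀ := by
    intro ω
    induction ω with
    | nil => simp [hsq]
    | cons s ω ih =>
      rw [List.map_cons, cs.wordProd_cons, cs.wordProd_cons, ih, hd]
      calc w₀ * cs.simple s * w₀ * (w₀ * cs.wordProd ω * w₀) =
          w₀ * cs.simple s * (w₀ * w₀) * cs.wordProd ω * w₀ := by group
        _ = w₀ * (cs.simple s * cs.wordProd ω) * w₀ := by rw [hsq, mul_one, mul_assoc w₀]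
  have hmap : ∀ (ω : List B) (η : PitmanPath T V),
      map (-((w₀ : V ≃L[ℝ] V) : V →L[ℝ] V)) (pitmanWord α αv ω η) =
        pitmanWord α αv (ω.map d) (map (-((w₀ : V ≃L[ℝ] V) : V →L[ℝ] V)) η) := by
    intro ω η
    induction ω with
    | nil => rfl
    | cons s ω ih =>
      rw [List.map_cons, pitmanWord_cons, pitmanWord_cons, ← ih]
      refine map_pitman _ (hk s).le ?_ (hcoroot s) _
      rw [neg_apply, ContinuousLinearEquiv.coe_coe, hroot, neg_smul, neg_neg]
  obtain ⟨ω, hω, h⟩ := cs.exists_isReduced w₀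
  have h1 : cs.wordProd (ω.map d) = w₀ := by
    rw [hword, ← h, hsq, one_mul]
  have h2 : cs.IsReduced (ω.map d) := by
    rw [CoxeterSystem.IsReduced, h1, List.length_map, ← hω.eq, ← h]
  rw [← pitmanWord_eq_pitmanOp hα h2 h1, ← hmap, pitmanWord_eq_pitmanOp hα hω h.symm]

/-- With p = P_sη(t), the vector η(t) is a convex combination of p and its reflection in s, because
the running infimum lies between minus the coroot value of p and 0. Hence π(t) lies in the convex
hull of the W-orbit of the transformed value. -/
theorem apply_mem_of_pitmanWord_apply (hα : IsSimpleRootSystem cs α αv) {v : V} (ω : List B)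
    (π : PitmanPath T V) (t : Set.Icc (0 : ℝ) T)
    (h : ∀ w : W, v - (w : V ≃L[ℝ] V) (pitmanWord α αv ω π t) ∈ rootCone α) (w : W) :
    v - (w : V ≃L[ℝ] V) (π t) ∈ rootCone α := by
  induction ω generalizing w with
  | nil => exact h w
  | cons s ω ih =>
    refine ih (fun w => ?_) w
    rw [pitmanWord_cons] at h
    set η := pitmanWord α αv ω π
    have h1 := runInf_coroot_nonpos (αv s) η t
    have h2 := runInf_le (continuous_coroot (αv s) η) (le_refl t)
    have h3 := congrFun (coroot_pitman_self (hα.pairing_self s) η) t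
    have h4 : η t = pitman (α s) (αv s) η t + runInf (fun r => αv s (η r)) t • α s := by
      rw [pitman_apply]
      abel
    generalize runInf (fun r => αv s (η r)) t = x at h1 h2 h3 h4
    generalize pitman (α s) (αv s) η t = p at h h3 h4
    rcases (show 0 ≤ αv s p by linarith).eq_or_lt with h0 | h0
    · have hx : x = 0 := by linarith
      rw [h4, hx, zero_smul, add_zero]
      exact h w
    · have h5 : v - (w : V ≃L[ℝ] V) (η t) =
          (1 - -x / αv s p) • (v - (w : V ≃L[ℝ] V) p) +
            (-x / αv s p) • (v - ((w * cs.simple s : W) : V ≃L[ℝ] V) p) := by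
        have h6 : x • (w : V ≃L[ℝ] V) (α s) =
            (-(-x / αv s p) * αv s p) • (w : V ≃L[ℝ] V) (α s) := by
          congr 1
          field_simp
        rw [h4, IsSimpleRootSystem.coe_mul_apply, hα.reflection]
        simp only [map_add, map_sub, map_smul]
        rw [h6]
        module
      rw [h5]
      refine add_mem_rootCone (smul_mem_rootCone (h w) ?_) (smul_mem_rootCone (h _) ?_)
      · rw [sub_nonneg, div_le_one h0]
        linarith
      · exact div_nonneg (by linarith) h0.le

variable [hT : Fact (0 < T)]

/-- Letter by letter: PκP_s = PP_sκP_s = PP_sκ = Pκ. -/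
theorem pitmanOp_kappa_pitmanOp (hα : IsSimpleRootSystem cs α αv)
    (hw₀ : ∀ w, cs.length w ≤ cs.length w₀) (π : PitmanPath T V) (w : W) :
    pitmanOp cs α αv w₀ (kappa (pitmanOp cs α αv w π)) = pitmanOp cs α αv w₀ (kappa π) := by
  have : ∀ ω : List B, pitmanOp cs α αv w₀ (kappa (pitmanWord α αv ω π)) =
      pitmanOp cs α αv w₀ (kappa π) := by
    intro ω
    induction ω with
    | nil => rfl
    | cons s ω ih =>
      rw [pitmanWord_cons, ← pitmanOp_pitman hα hw₀ s, pitman_kappa_pitman (hα.pairing_self s),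
        pitmanOp_pitman hα hw₀, ih]
  exact this _

theorem dualI_eq (hα : IsSimpleRootSystem cs α αv) (hw₀ : ∀ w, cs.length w ≤ cs.length w₀)
    (π : PitmanPath T V) : dualI cs α αv w₀ π =
      map (-((w₀ : V ≃L[ℝ] V) : V →L[ℝ] V)) (pitmanOp cs α αv w₀ (kappa π)) :=
  pitmanOp_map_neg_longest hα hw₀ _

theorem dualI_dualI (hα : IsSimpleRootSystem cs α αv) (hw₀ : ∀ w, cs.length w ≤ cs.length w₀)
    (π : PitmanPath T V) :
    dualI cs α αv w₀ (dualI cs α αv w₀ π) = pitmanOp cs α αv w₀ π := by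
  rw [dualI_eq hα hw₀ π, dualI, ← map_kappa, neg_longest_comp_self hα hw₀,
    pitmanOp_kappa_pitmanOp hα hw₀, kappa_kappa]

theorem dualI_pitmanOp (hα : IsSimpleRootSystem cs α αv)
    (hw₀ : ∀ w, cs.length w ≤ cs.length w₀) (π : PitmanPath T V) :
    dualI cs α αv w₀ (pitmanOp cs α αv w₀ π) = dualI cs α αv w₀ π := by
  rw [dualI_eq hα hw₀, dualI_eq hα hw₀, pitmanOp_kappa_pitmanOp hα hw₀]

theorem isDominant_dualI (hα : IsSimpleRootSystem cs α αv)
    (hw₀ : ∀ w, cs.length w ≤ cs.length w₀) (π : PitmanPath T V) :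
    IsDominant αv (dualI cs α αv w₀ π) :=
  isDominant_pitmanOp hα hw₀ _

/-- The path to which P is applied in I ends at w₀π(T), so π(T) lies in the convex hull of the orbit
of the dominant vector Iπ(T). -/
theorem dualI_endTime_sub_mem_rootCone (hα : IsSimpleRootSystem cs α αv)
    (hw₀ : ∀ w, cs.length w ≤ cs.length w₀) (π : PitmanPath T V) :
    dualI cs α αv w₀ π (endTime T) - π (endTime T) ∈ rootCone α := by
  have h1 := apply_mem_of_pitmanWord_apply hα _ _ (endTime T)
    (hα.sub_apply_mem_rootCone (fun s => isDominant_dualI hα hw₀ π s (endTime T))) w₀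
  have hsq := longest_mul_self cs hα.isCartanMatrix hα.coxeterMatrix_ne_zero hw₀
  have h2 := IsSimpleRootSystem.coe_mul_apply w₀ w₀ (π (endTime T))
  rw [hsq, IsSimpleRootSystem.coe_one_apply] at h2
  have h3 : (w₀ : V ≃L[ℝ] V) ((-((w₀ : V ≃L[ℝ] V) : V →L[ℝ] V)) (-π (endTime T))) =
      π (endTime T) := by
    simpa using h2.symm
  rw [map_apply, kappa_endTime, h3] at h1
  exact h1

theorem dualI_endTime_of_isDominant (hα : IsSimpleRootSystem cs α αv)
    (hw₀ : ∀ w, cs.length w ≤ cs.length w₀) {π : PitmanPath T V} (h : IsDominant αv π) :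
    dualI cs α αv w₀ π (endTime T) = π (endTime T) := by
  refine hα.eq_of_sub_mem_rootCone hw₀ (dualI_endTime_sub_mem_rootCone hα hw₀ π) ?_
  have := dualI_endTime_sub_mem_rootCone hα hw₀ (dualI cs α αv w₀ π)
  rwa [dualI_dualI hα hw₀, pitmanOp_eq_self h] at this

end Longest

end Involution

end PitmanPath

theorem mainTheorem7 {V : Type*} [AddCommGroup V] [Module ℝ V] [TopologicalSpace V]
    [IsTopologicalAddGroup V] [ContinuousSMul ℝ V]
    {B : Type*} [Finite B] {M : CoxeterMatrix B}
    (W : Subgroup (V ≃L[ℝ] V)) [Finite W] (cs : CoxeterSystem M W)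
    (α : B → V) (αv : B → V →L[ℝ] ℝ) (hα : IsSimpleRootSystem cs α αv)
    (w₀ : W) (hw₀ : ∀ w : W, cs.length w ≤ cs.length w₀)
    (T : ℝ) [Fact (0 < T)] :
    (∀ ω : List B, cs.IsReduced ω → cs.wordProd ω = w₀ → ∀ π : PitmanPath T V,
      PitmanPath.pitmanWord α αv ω π = PitmanPath.pitmanOp cs α αv w₀ π) ∧
    (∀ π : PitmanPath T V,
      PitmanPath.dualI cs α αv w₀ (PitmanPath.dualI cs α αv w₀ π) =
        PitmanPath.pitmanOp cs α αv w₀ π) ∧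
    (∀ π : PitmanPath T V, PitmanPath.IsDominant αv π →
      PitmanPath.IsDominant αv (PitmanPath.dualI cs α αv w₀ π) ∧
        PitmanPath.dualI cs α αv w₀ (PitmanPath.dualI cs α αv w₀ π) = π) ∧
    (∀ π : PitmanPath T V,
      PitmanPath.dualI cs α αv w₀ (PitmanPath.pitmanOp cs α αv w₀ π) =
        PitmanPath.dualI cs α αv w₀ π) ∧
    (∀ π : PitmanPath T V,
      PitmanPath.dualI cs α αv w₀ π (PitmanPath.endTime T) =
        PitmanPath.pitmanOp cs α αv w₀ π (PitmanPath.endTime T)) ∧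
    (∀ π : PitmanPath T V, PitmanPath.IsDominant αv π →
      PitmanPath.dualI cs α αv w₀ π (PitmanPath.endTime T) = π (PitmanPath.endTime T)) := by
  have hdom : ∀ π : PitmanPath T V, PitmanPath.IsDominant αv π →
      PitmanPath.dualI cs α αv w₀ π (PitmanPath.endTime T) = π (PitmanPath.endTime T) :=
    fun π h => PitmanPath.dualI_endTime_of_isDominant hα hw₀ h
  refine ⟨fun ω hω h π => PitmanPath.pitmanWord_eq_pitmanOp hα hω h π,
    PitmanPath.dualI_dualI hα hw₀, fun π h => ⟨PitmanPath.isDominant_dualI hα hw₀ π, ?_⟩,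
    PitmanPath.dualI_pitmanOp hα hw₀, fun π => ?_, hdom⟩
  · rw [PitmanPath.dualI_dualI hα hw₀, PitmanPath.pitmanOp_eq_self h]
  · rw [← PitmanPath.dualI_pitmanOp hα hw₀]
    exact hdom _ (PitmanPath.isDominant_pitmanOp hα hw₀ π)
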